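/- **Theorem 1.1.** For a group $G$ with center $Z(G)$, the commuting graph $\Gamma(G)$ has vertex set $G\setminus Z(G)$, two distinct vertices being adjacent if and only if they commute. Call $G$ strong $5$-star free if $\Gamma(G)$ has no subgraph, induced or not, isomorphic to the star $K_{1,5}$. Then, up to isomorphism, the finite non-abelian strong $5$-star free groups are exactly $$S_3,\quad D_{10},\quad A_4,\quad \mathrm{GA}(1,5),\quad A_5,\quad D_8,\quad Q_8,\quad D_{12},\quad C_3\rtimes C_4,\quad \mathrm{SL}(2,3)$$ and the six groups $$(C_4\times C_2)\rtimes_1 C_2,\quad C_4\rtimes C_4,\quad C_8\rtimes C_2,\quad D_8\times C_2,\quad Q_8\times C_2,\quad (C_4\times C_2)\rtimes_2 C_2.$$ Moreover, a group is isomorphic to one of these six if and only if it has order $16$ and its center has order $4$. Here $C_n$ is the cyclic group of order $n$, $D_{2n}$ is the dihedral group of order $2n$, $Q_8$ is the quaternion group of order $8$, $\mathrm{GA}(1,5)$ is the group of invertible affine maps of $\mathbb{F}_5$, and $\mathrm{SL}(2,3)=\mathrm{SL}_2(\mathbb{F}_3)$. In the semidirect products a generator of the right-hand factor acts on the left-hand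 factor as follows: on $C_3$ in $C_3\rtimes C_4$ and on $C_4$ in $C_4\rtimes C_4$ by $x\mapsto x^{-1}$; on $C_8$ by $x\mapsto x^5$; on $C_4\times C_2=\langle a\rangle\times\langle b\rangle$ by $a\mapsto ab,\ b\mapsto b$ in $\rtimes_1$ and by $a\mapsto a,\ b\mapsto a^2b$ in $\rtimes_2$. -/

import Mathlib

/-- The commuting graph of a group `G`: the vertices are the non-central elements of `G`, and two
distinct vertices are joined by an edge if they commute. -/
def commutingGraph (G : Type*) [Group G] : SimpleGraph {x : G // x ∉ Subgroup.center G} where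
  Adj x y := x ≠ y ∧ Commute (x : G) (y : G)
  symm := ⟨fun _ _ h => ⟨h.1.symm, h.2.symm⟩⟩
  loopless := ⟨fun _ h => h.1 rfl⟩

/-- `G` is strong `k`-star free: the star `K_{1,k}` is not isomorphic to a subgraph, induced or
not, of the commuting graph of `G`. -/
def StrongStarFree (k : ℕ) (G : Type*) [Group G] : Prop :=
  (completeBipartiteGraph (Fin 1) (Fin k)).Free (commutingGraph G)

/-- The cyclic group of order `n` (for `n ≥ 1`), written multiplicatively. -/
abbrev Cyc (n : ℕ) : Type := Multiplicative (ZMod n)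

/-- For an endomorphism `f` of `N` with `f ∘ f = id` and an even `n ≥ 1`, the action of the cyclic
group of order `n` on `N` in which the standard generator acts as `f`. -/
def involutiveAction {N : Type*} [Group N] (n : ℕ) [NeZero n] (hn : 2 ∣ n)
    (f : N →* N) (hf : ∀ x, f (f x) = x) : Cyc n →* MulAut N :=
  let α : MulAut N :=
    { toFun := f, invFun := f, left_inv := hf, right_inv := hf, map_mul' := f.map_mul }
  have hα : α ^ n = 1 := by
    obtain ⟨m, rfl⟩ := hn
    have h2 : α ^ 2 = 1 := by
      ext x
      rw [pow_two]
      exact hf x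
    rw [pow_mul, h2, one_pow]
  { toFun := fun k => α ^ (Multiplicative.toAdd k).val
    map_one' := by simp
    map_mul' := fun a b => by
      rw [toAdd_mul, ZMod.val_add, ← pow_eq_pow_mod _ hα, pow_add] }

/-- The endomorphism of `C_4 × C_2 = ⟨a⟩ × ⟨b⟩` with `a ↦ a b` and `b ↦ b`. -/
def shear₁ : Cyc 4 × Cyc 2 →* Cyc 4 × Cyc 2 where
  toFun p := (p.1, Multiplicative.ofAdd (Multiplicative.toAdd p.2 + (Multiplicative.toAdd p.1).cast))
  map_one' := by decide
  map_mul' := by decide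

/-- The endomorphism of `C_4 × C_2 = ⟨a⟩ × ⟨b⟩` with `a ↦ a` and `b ↦ a² b`. -/
def shear₂ : Cyc 4 × Cyc 2 →* Cyc 4 × Cyc 2 where
  toFun p :=
    (Multiplicative.ofAdd (Multiplicative.toAdd p.1 + 2 * (Multiplicative.toAdd p.2).cast), p.2)
  map_one' := by decide
  map_mul' := by decide

/-- The semidirect product `C_3 ⋊ C_4`, the generator of `C_4` acting on `C_3` by inversion. -/
abbrev C3sdC4 : Type :=
  Cyc 3 ⋊[involutiveAction 4 (by decide) (invMonoidHom : Cyc 3 →* Cyc 3) (by decide)] Cyc 4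

/-- The semidirect product `C_4 ⋊ C_4`, the generator of the second factor acting by inversion. -/
abbrev C4sdC4 : Type :=
  Cyc 4 ⋊[involutiveAction 4 (by decide) (invMonoidHom : Cyc 4 →* Cyc 4) (by decide)] Cyc 4

/-- The semidirect product `C_8 ⋊ C_2`, the generator of `C_2` acting by `x ↦ x ^ 5`. -/
abbrev C8sdC2 : Type :=
  Cyc 8 ⋊[involutiveAction 2 (by decide) (powMonoidHom 5 : Cyc 8 →* Cyc 8) (by decide)] Cyc 2

/-- The semidirect product `(C_4 × C_2) ⋊ C_2` with action `a ↦ a b`, `b ↦ b`. -/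
abbrev C4C2sdC2₁ : Type :=
  (Cyc 4 × Cyc 2) ⋊[involutiveAction 2 (by decide) shear₁ (by decide)] Cyc 2

/-- The semidirect product `(C_4 × C_2) ⋊ C_2` with action `a ↦ a`, `b ↦ a² b`. -/
abbrev C4C2sdC2₂ : Type :=
  (Cyc 4 × Cyc 2) ⋊[involutiveAction 2 (by decide) shear₂ (by decide)] Cyc 2

/-- `G` is isomorphic to one of the six groups `(C_4 × C_2) ⋊ C_2` (with either of the two actions
above), `C_4 ⋊ C_4`, `C_8 ⋊ C_2`, `D_8 × C_2`, `Q_8 × C_2`. -/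
def IsoToOneOfSix (G : Type*) [Group G] : Prop :=
  Nonempty (G ≃* C4C2sdC2₁) ∨ Nonempty (G ≃* C4sdC4) ∨ Nonempty (G ≃* C8sdC2) ∨
  Nonempty (G ≃* DihedralGroup 4 × Cyc 2) ∨ Nonempty (G ≃* QuaternionGroup 2 × Cyc 2) ∨
  Nonempty (G ≃* C4C2sdC2₂)

open Subgroup
open scoped Pointwise

/-! Write Z for the center and C(x) for the centralizer of x. The neighbours of a noncentral x in
the commuting graph are the elements of C(x) \ Z other than x, so there is no star with k leaves
exactly when |C(x)| ≤ |Z| + k for every noncentral x (`strongStarFree_iff`). For k = 5, since |Z|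
divides |C(x)| properly, |Z| ≤ 5.

Large prime powers in |G| force large centralizers. If p does not divide |Z| and p^k divides |G|, a
nontrivial element of the center of a subgroup of order p^k is noncentral in G, and its centralizer
has order divisible by p^k |Z| (`exists_pow_mul_card_center_dvd_card_centralizer`). Primes dividing
|Z| are controlled by abelian subgroups of order p² and by small conjugacy classes in p-groups. This
excludes |Z| = 3 and 5. If |Z| = 1, then |G| divides 60, and subgroups of order 15 are impossible,
which leaves 6, 10, 12, 20 and 60. If |Z| = 2, then |G| is 8, 12 or 24. If |Z| = 4, every noncentral
centralizer has order 8 and |G| is 16 or 32; a commutator computation excludes 32.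

Apart from A_4 and A_5, which come from actions on cosets, each group is recognized from generators
and relations. If generators of G and of H satisfy the same relations, the subgroup of G × H
generated by the pairs has order at most |G| = |H| and projects onto both factors, so it is the
graph of an isomorphism (`nonempty_mulEquiv_of_closure`). In order 16 with |Z| = 4, commutators are
central of order at most 2, and normalizing the squares of two noncommuting elements leaves six
systems of relations.

Conversely, a noncentral centralizer has at most |G|/2 elements; this settles every listed group
except GA(1,5), A_5 and SL(2,3), where centralizers are computed. -/

/-! ### Star-freeness as a bound on centralizers -/

theorem strongStarFree_iff {G : Type*} [Group G] [Finite G] (k : ℕ) :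
    StrongStarFree k G ↔ ∀ x : G, x ∉ center G →
      Nat.card (centralizer {x}) ≤ Nat.card (center G) + k := by
  have key : ∀ x : G, Nat.card (centralizer {x}) =
      ((centralizer {x} : Set G) \ (center G : Set G)).ncard + Nat.card (center G) := by
    intro x
    have h := Set.ncard_sdiff_add_ncard_of_subset
      (s := (center G : Set G)) (t := (centralizer {x} : Set G)) (center_le_centralizer _)
    rw [← Nat.card_coe_set_eq (center G : Set G), ← Nat.card_coe_set_eq (centralizer {x} : Set G)]
      at h
    exact h.symm
  have hmem : ∀ x y : G, y ∈ (centralizer {x} : Set G) \ (center G : Set G) ↔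
      Commute x y ∧ y ∉ center G := by
    intro x y
    simp only [Set.mem_sdiff, SetLike.mem_coe, mem_centralizer_singleton_iff]
    exact ⟨fun h => ⟨h.1.symm, h.2⟩, fun h => ⟨h.1.symm, h.2⟩⟩
  constructor
  · intro h x hx
    by_contra hlt
    apply h
    have hS := key x
    set S := (centralizer {x} : Set G) \ (center G : Set G) with hSdef
    have hxS : x ∈ S := (hmem x x).2 ⟨Commute.refl x, hx⟩
    -- If the bound fails, `S` has more than `k` elements; one is spent on the center of the star.
    have h1 : k ≤ (S \ {x}).ncard := by
      rw [Set.ncard_sdiff_singleton_of_mem hxS]; omega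
    have h2 : Nonempty (Fin k ↪ (S \ {x} : Set G)) := by
      have : Finite (S \ {x} : Set G) := inferInstance
      have := Fintype.ofFinite (S \ {x} : Set G)
      apply Function.Embedding.nonempty_of_card_le
      rwa [Fintype.card_fin, ← Nat.card_eq_fintype_card, Nat.card_coe_set_eq]
    obtain ⟨e⟩ := h2
    have he : ∀ i, Commute x (e i : G) ∧ (e i : G) ∉ center G := fun i => (hmem x _).1 (e i).2.1
    have hne : ∀ i, (e i : G) ≠ x := fun i => (e i).2.2
    refine ⟨⟨⟨Sum.elim (fun _ => ⟨x, hx⟩) (fun i => ⟨e i, (he i).2⟩), ?_⟩, ?_⟩⟩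
    · rintro (a | a) (b | b) hab
      · simp at hab
      · exact ⟨fun h => hne b (congrArg Subtype.val h).symm, (he b).1⟩
      · exact ⟨fun h => hne a (congrArg Subtype.val h), (he a).1.symm⟩
      · simp at hab
    · rintro (a | a) (b | b) hab
      · exact congrArg _ (Subsingleton.elim _ _)
      · exact absurd (congrArg Subtype.val hab).symm (hne b)
      · exact absurd (congrArg Subtype.val hab) (hne a)
      · have h3 : (e a : G) = e b := congrArg (fun v : {x : G // x ∉ center G} => (v : G)) hab
        exact congrArg _ (e.injective (Subtype.ext h3))
  · rintro h ⟨f⟩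
    have hx : (f (Sum.inl 0)).1 ∉ center G := (f (Sum.inl 0)).2
    have h1 := h _ hx
    rw [key] at h1
    set x : G := (f (Sum.inl 0)).1
    have hf : ∀ v, ((f v : {x : G // x ∉ center G}) : G) ∈
        (centralizer {x} : Set G) \ (center G : Set G) := by
      rintro (a | a)
      · rw [Subsingleton.elim a 0]
        exact (hmem _ _).2 ⟨Commute.refl x, hx⟩
      · have : (completeBipartiteGraph (Fin 1) (Fin k)).Adj (Sum.inl 0) (Sum.inr a) := by simp
        exact (hmem _ _).2 ⟨(f.toHom.map_adj this).2, (f _).2⟩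
    have h2 : Nat.card (Fin 1 ⊕ Fin k) ≤
        Nat.card ((centralizer {x} : Set G) \ (center G : Set G) : Set G) :=
      Nat.card_le_card_of_injective (fun v => ⟨_, hf v⟩) fun a b hab => by
        have h3 : ((f a).1 : G) = (f b).1 := Subtype.mk.inj hab
        exact f.injective (Subtype.ext h3)
    rw [Nat.card_coe_set_eq] at h2
    simp at h2
    omega

theorem MulEquiv.map_center_iff {G H : Type*} [Group G] [Group H] (e : G ≃* H) (x : G) :
    e x ∈ center H ↔ x ∈ center G := by
  simp only [mem_center_iff]
  constructor
  · intro h g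
    apply e.injective
    simpa using h (e g)
  · intro h g
    have := congrArg e (h (e.symm g))
    simpa using this

theorem MulEquiv.card_center {G H : Type*} [Group G] [Group H] (e : G ≃* H) :
    Nat.card (center G) = Nat.card (center H) :=
  Nat.card_congr (e.toEquiv.subtypeEquiv fun x => (e.map_center_iff x).symm)

theorem StrongStarFree.of_mulEquiv {G H : Type*} [Group G] [Group H] (e : G ≃* H) {k : ℕ}
    (h : StrongStarFree k H) : StrongStarFree k G := by
  rintro ⟨f⟩
  let g : commutingGraph G →g commutingGraph H :=
    ⟨fun x => ⟨e x, fun hx => x.2 ((e.map_center_iff _).1 hx)⟩, fun {a b} hab =>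
      ⟨fun h => hab.1 (Subtype.ext (e.injective (congrArg Subtype.val h))), hab.2.map e⟩⟩
  have hg : Function.Injective g := fun a b hab =>
    Subtype.ext (e.injective (congrArg Subtype.val hab))
  exact h ⟨⟨g.comp f.toHom, hg.comp f.injective⟩⟩

/-! ### Counting: conjugacy classes, the center, generated subgroups -/

section Counting

variable {G : Type*} [Group G] [Finite G]

/-- Orbit-stabilizer as an inequality: cosets of the centralizer inject into the conjugates of `x`,
all of which lie in `S`. -/
theorem card_le_of_conj_mem {x : G} {S : Set G} (h : ∀ g, g * x * g⁻¹ ∈ S) :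
    Nat.card G ≤ Nat.card (centralizer {x}) * S.ncard := by
  rw [← (centralizer {x}).card_mul_index]
  apply Nat.mul_le_mul_left
  have hlift : ∀ a b : G, (QuotientGroup.leftRel (centralizer {x})) a b →
      a * x * a⁻¹ = b * x * b⁻¹ := by
    intro a b hab
    rw [QuotientGroup.leftRel_apply, mem_centralizer_singleton_iff] at hab
    have : b = a * (a⁻¹ * b) := by group
    rw [this, mul_assoc a _ x, hab]; group
  rw [index, ← Nat.card_coe_set_eq S]
  apply Nat.card_le_card_of_injective
    (fun q : G ⧸ centralizer {x} => Quotient.lift (s := QuotientGroup.leftRel (centralizer {x}))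
      (fun g => (⟨g * x * g⁻¹, h g⟩ : S)) (fun a b hab => Subtype.ext (hlift a b hab)) q)
  intro p q
  refine Quotient.inductionOn₂' p q fun a b hab => ?_
  have hab' : a * x * a⁻¹ = b * x * b⁻¹ := congrArg Subtype.val hab
  refine Quotient.sound' ?_
  rw [QuotientGroup.leftRel_apply, mem_centralizer_singleton_iff]
  have := congrArg (fun g => a⁻¹ * g * b) hab'
  simp only [mul_assoc, inv_mul_cancel_left, inv_mul_cancel, mul_one] at this
  rw [mul_assoc, ← this]

/-- A group of order 1, 2 or 3 is cyclic, and a cyclic quotient by the center forces commutativity.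
-/
theorem four_mul_card_center_le (h : ∃ x y : G, x * y ≠ y * x) :
    4 * Nat.card (center G) ≤ Nat.card G := by
  obtain ⟨x, y, hxy⟩ := h
  rw [← (center G).index_mul_card]
  apply Nat.mul_le_mul_right
  by_contra! hlt
  have h0 : (center G).index ≠ 0 := index_ne_zero_of_finite
  have : IsCyclic (G ⧸ center G) := by
    have hc : Nat.card (G ⧸ center G) = (center G).index := rfl
    generalize (center G).index = i at *
    interval_cases i
    · exact absurd rfl h0
    · have := (Nat.card_eq_one_iff_unique.1 hc).1
      infer_instance
    · exact isCyclic_of_prime_card (hp := ⟨Nat.prime_two⟩) hc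
    · exact isCyclic_of_prime_card (hp := ⟨Nat.prime_three⟩) hc
  have := (QuotientGroup.mk' (center G)).isMulCommutative_of_isCyclic_of_ker_le_center (by simp)
  exact hxy (mul_comm' x y)

/-- Since `b` normalizes `closure S` and `b ^ m` lies in it, every element of the larger group is `b
^ i * n` with `i < m` and `n` in `closure S`. Adjoining generators one at a time then bounds the
order of a group from its relations. -/
theorem card_closure_insert_le (S : Set G) (b : G) (m : ℕ) (hm : 0 < m)
    (hb : b ^ m ∈ closure S) (hS : ∀ s ∈ S, b * s * b⁻¹ ∈ closure S) :
    Nat.card (closure (insert b S)) ≤ m * Nat.card (closure S) := by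
  have hN : ∀ n ∈ closure S, b * n * b⁻¹ ∈ closure S := by
    have : closure S ≤ (closure S).comap (MulAut.conj b).toMonoidHom := by
      rw [closure_le]
      intro s hs
      simpa using hS s hs
    intro n hn
    simpa using this hn
  have hnorm : b ∈ normalizer (closure S : Set G) := mem_normalizer_fintype hN
  have hz : zpowers b ≤ normalizer (closure S : Set G) := by simpa using hnorm
  have hsup : closure (insert b S) = zpowers b ⊔ closure S := by
    rw [Set.insert_eq, Subgroup.closure_union, zpowers_eq_closure]
  have hcoe : ((zpowers b ⊔ closure S : Subgroup G) : Set G) = zpowers b * closure S :=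
    coe_mul_of_left_le_normalizer_right _ _ hz
  rw [hsup]
  have hsurj : ∀ g : (zpowers b ⊔ closure S : Subgroup G), ∃ p : Fin m × closure S,
      b ^ (p.1 : ℕ) * (p.2 : G) = g := by
    rintro ⟨g, hg⟩
    rw [← SetLike.mem_coe, hcoe] at hg
    obtain ⟨_, ⟨k, rfl⟩, n, hn, rfl⟩ := hg
    have hm' : (0 : ℤ) < m := by exact_mod_cast hm
    have h0 := Int.emod_nonneg k hm'.ne'
    have h1 := Int.emod_lt_of_pos k hm'
    refine ⟨(⟨(k % m).toNat, by omega⟩, ⟨(b ^ m) ^ (k / m) * n,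
      mul_mem (zpow_mem hb _) hn⟩), ?_⟩
    have : b ^ (k % (m : ℤ)).toNat = b ^ (k % (m : ℤ)) := by
      rw [← zpow_natCast, Int.toNat_of_nonneg h0]
    simp only [this, ← mul_assoc]
    rw [← zpow_natCast, ← zpow_mul, ← zpow_add, Int.emod_add_mul_ediv]
  choose f hf using hsurj
  have := Nat.card_le_card_of_injective f fun a b hab => Subtype.ext (by rw [← hf a, ← hf b, hab])
  simpa using this

end Counting

theorem card_closure_singleton_le {G : Type*} [Group G] (a : G) (n : ℕ) (hn : 0 < n)
    (ha : a ^ n = 1) :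
    Nat.card (closure {a}) ≤ n := by
  rw [← zpowers_eq_closure, Nat.card_zpowers]
  exact Nat.le_of_dvd hn (orderOf_dvd_of_pow_eq_one ha)

/-! ### Isomorphisms from matching generators and relations -/

section Graph

variable {G H : Type*} [Group G] [Group H] [Finite G] [Finite H]

/-- Both projections of `closure S` are surjective, and the bound on its order makes them bijective,
so it is the graph of an isomorphism. -/
theorem nonempty_mulEquiv_of_closure (S : Set (G × H)) (h1 : closure (Prod.fst '' S) = ⊤)
    (h2 : closure (Prod.snd '' S) = ⊤) (hS : Nat.card (closure S) ≤ Nat.card G)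
    (hGH : Nat.card G = Nat.card H) : Nonempty (G ≃* H) := by
  have s1 : Function.Surjective ((MonoidHom.fst G H).comp (closure S).subtype) := by
    rw [← MonoidHom.range_eq_top, MonoidHom.range_comp, range_subtype, MonoidHom.map_closure]
    exact h1
  have s2 : Function.Surjective ((MonoidHom.snd G H).comp (closure S).subtype) := by
    rw [← MonoidHom.range_eq_top, MonoidHom.range_comp, range_subtype, MonoidHom.map_closure]
    exact h2
  have c1 : Nat.card (closure S) = Nat.card G :=
    le_antisymm hS (Nat.card_le_card_of_surjective _ s1)
  have b1 := (Nat.bijective_iff_surjective_and_card _).2 ⟨s1, c1⟩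
  have b2 := (Nat.bijective_iff_surjective_and_card _).2 ⟨s2, c1.trans hGH⟩
  exact ⟨(MulEquiv.ofBijective _ b1).symm.trans (MulEquiv.ofBijective _ b2)⟩

/-- `G = ⟨a, b⟩` with `a ^ n = 1`, `b a b⁻¹ = a ^ r`, `b ^ m = a ^ s` and order `m * n`. -/
structure IsMetacyclicPair {G : Type*} [Group G] (n m r s : ℕ) (a b : G) : Prop where
  pow_left : a ^ n = 1
  conj : b * a * b⁻¹ = a ^ r
  pow_right : b ^ m = a ^ s
  closure_eq_top : closure {b, a} = ⊤
  card : Nat.card G = m * n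

theorem IsMetacyclicPair.nonempty_mulEquiv {n m r s : ℕ} (hn : 0 < n) (hm : 0 < m)
    {a b : G} {a' b' : H} (h : IsMetacyclicPair n m r s a b)
    (h' : IsMetacyclicPair n m r s a' b') : Nonempty (G ≃* H) := by
  refine nonempty_mulEquiv_of_closure {(b, b'), (a, a')} ?_ ?_ ?_ (h.card.trans h'.card.symm)
  · simpa [Set.image_insert_eq] using h.closure_eq_top
  · simpa [Set.image_insert_eq] using h'.closure_eq_top
  · have ha : (a, a') ∈ closure {(a, a')} := mem_closure_singleton_self _
    have h1 := card_closure_insert_le {(a, a')} (b, b') m hm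
      (by
        have : (b, b') ^ m = (a, a') ^ s := Prod.ext h.pow_right h'.pow_right
        rw [this]; exact pow_mem ha _)
      (by
        rintro _ rfl
        have : (b, b') * (a, a') * (b, b')⁻¹ = (a, a') ^ r := Prod.ext h.conj h'.conj
        rw [this]; exact pow_mem ha _)
    have h2 := card_closure_singleton_le (a, a') n hn (Prod.ext h.pow_left h'.pow_left)
    rw [h.card]
    exact h1.trans (Nat.mul_le_mul_left _ h2)

end Graph

/-! ### Generating pairs of the metacyclic groups -/

instance SemidirectProduct.instFintype {N K : Type*} [Group N] [Group K] [Fintype N] [Fintype K]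
    (φ : K →* MulAut N) : Fintype (N ⋊[φ] K) :=
  Fintype.ofEquiv (N × K) SemidirectProduct.equivProd.symm

theorem closure_pair_eq_top {G : Type*} [Group G] {m n : ℕ} {a b : G}
    (h : ∀ t : G, ∃ i : Fin m, ∃ j : Fin n, t = b ^ (i : ℕ) * a ^ (j : ℕ)) :
    closure {b, a} = ⊤ := by
  rw [eq_top_iff]
  rintro t -
  obtain ⟨i, j, rfl⟩ := h t
  exact mul_mem (pow_mem (subset_closure (by simp)) _) (pow_mem (subset_closure (by simp)) _)

theorem isMetacyclicPair_perm :
    IsMetacyclicPair 3 2 2 0 (finRotate 3) (Equiv.swap (0 : Fin 3) 1) where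
  pow_left := by decide
  conj := by decide
  pow_right := by decide
  closure_eq_top := closure_pair_eq_top (m := 2) (n := 3) (by decide)
  card := by rw [Nat.card_eq_fintype_card]; decide

theorem isMetacyclicPair_dihedralGroup (n : ℕ) [NeZero n] :
    IsMetacyclicPair n 2 (n - 1) 0 (DihedralGroup.r (1 : ZMod n)) (DihedralGroup.sr 0) where
  pow_left := by simp
  conj := by
    have : ((n - 1 : ℕ) : ZMod n) = -1 := by
      rw [Nat.cast_sub (NeZero.one_le)]; simp
    simp [this]
  pow_right := by simp [pow_two]
  closure_eq_top := by
    rw [eq_top_iff]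
    rintro (i | i) -
    · have : DihedralGroup.r i = DihedralGroup.r (1 : ZMod n) ^ i.val := by simp
      rw [this]
      exact pow_mem (subset_closure (by simp)) _
    · have : DihedralGroup.sr i = DihedralGroup.sr 0 * DihedralGroup.r (1 : ZMod n) ^ i.val := by
        simp
      rw [this]
      exact mul_mem (subset_closure (by simp)) (pow_mem (subset_closure (by simp)) _)
  card := DihedralGroup.nat_card

theorem isMetacyclicPair_quaternionGroup :
    IsMetacyclicPair 4 2 3 2 (QuaternionGroup.a (1 : ZMod (2 * 2))) (QuaternionGroup.xa 0) where
  pow_left := by decide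
  conj := by decide
  pow_right := by decide
  closure_eq_top := closure_pair_eq_top (m := 2) (n := 4) (by decide)
  card := by rw [Nat.card_eq_fintype_card, QuaternionGroup.card]

/-- The square of the generator of `C_4` acts trivially, so together with `C_3` it generates a
cyclic subgroup of order 6 and index 2. The parameters then differ from those of `DihedralGroup 6`
only in the last one. -/
theorem isMetacyclicPair_C3sdC4 :
    IsMetacyclicPair 6 2 5 3 (⟨Multiplicative.ofAdd 1, Multiplicative.ofAdd 2⟩ : C3sdC4)
      ⟨1, Multiplicative.ofAdd 1⟩ where
  pow_left := by decide
  conj := by decide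
  pow_right := by decide
  closure_eq_top := closure_pair_eq_top (m := 2) (n := 6) (by decide)
  card := by rw [Nat.card_eq_fintype_card]; decide

/-! ### The affine group of the line over the field with five elements -/

section Affine

/-- The unit `2` of the field with five elements. -/
def unitTwo : (ZMod 5)ˣ := ⟨2, 3, by decide, by decide⟩

/-- The affine map `x ↦ 2 ^ k x + t` of the line over the field with five elements. -/
def affineFive (t : ZMod 5) (k : ℕ) : ZMod 5 ≃ᵃ[ZMod 5] ZMod 5 where
  toFun x := 2 ^ k * x + t
  invFun x := 3 ^ k * (x - t)
  left_inv x := by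
    have : (3 : ZMod 5) ^ k * 2 ^ k = 1 := by
      rw [← mul_pow, show (3 * 2 : ZMod 5) = 1 by decide, one_pow]
    linear_combination x * this
  right_inv x := by
    have : (3 : ZMod 5) ^ k * 2 ^ k = 1 := by
      rw [← mul_pow, show (3 * 2 : ZMod 5) = 1 by decide, one_pow]
    linear_combination (x - t) * this
  linear := LinearEquiv.smulOfUnit (unitTwo ^ k)
  map_vadd' p v := by
    have : LinearEquiv.smulOfUnit (unitTwo ^ k) v = 2 ^ k * v := by
      change ((unitTwo ^ k : (ZMod 5)ˣ) : ZMod 5) * v = 2 ^ k * v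
      rw [Units.val_pow_eq_pow_val]
      rfl
    rw [this]
    simp only [Equiv.coe_fn_mk, vadd_eq_add]
    ring

@[simp]
theorem affineFive_apply (t x : ZMod 5) (k : ℕ) : affineFive t k x = 2 ^ k * x + t := rfl

theorem affineFive_mul (t u : ZMod 5) (k l : ℕ) :
    affineFive t k * affineFive u l = affineFive (t + 2 ^ k * u) (k + l) := by
  ext x
  simp [AffineEquiv.mul_def]
  ring

theorem affineFive_zero : affineFive 0 0 = 1 := by
  ext x
  simp

theorem affineFive_mod (t : ZMod 5) (k : ℕ) : affineFive t k = affineFive t (k % 4) := by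
  ext x
  have : (2 : ZMod 5) ^ k = 2 ^ (k % 4) := pow_eq_pow_mod k (by decide)
  simp [this]

/-- An affine map of the line is determined by its values at 0 and 1, and 2 generates the unit group
modulo 5. -/
theorem affineFive_bijective :
    Function.Bijective fun p : ZMod 5 × Fin 4 => affineFive p.1 p.2 := by
  constructor
  · rintro ⟨t, k⟩ ⟨u, l⟩ h
    have h0 := congrArg (fun e => e 0) h
    have h1 := congrArg (fun e => e 1) h
    simp only [affineFive_apply, mul_zero, zero_add, mul_one] at h0 h1
    subst h0
    have : ∀ k l : Fin 4, (2 : ZMod 5) ^ (k : ℕ) = 2 ^ (l : ℕ) → k = l := by decide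
    rw [this k l (add_right_cancel h1)]
  · intro e
    have key : ∀ x, e x = (e 1 - e 0) * x + e 0 := by
      intro x
      have h0 : ∀ x : ZMod 5, e x = e.linear x + e 0 := by
        intro x
        have := e.map_vadd 0 x
        simpa using this
      have h1 : e.linear x = x * e.linear 1 := by
        have := e.linear.map_smul x 1
        simpa using this
      rw [h0 1, h0 x, h1]; ring
    have hne : e 1 - e 0 ≠ 0 := fun h =>
      absurd (e.injective (sub_eq_zero.1 h)) (by decide)
    have : ∀ u : ZMod 5, u ≠ 0 → ∃ k : Fin 4, u = 2 ^ (k : ℕ) := by decide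
    obtain ⟨k, hk⟩ := this _ hne
    refine ⟨(e 0, k), ?_⟩
    ext x
    simp only [affineFive_apply]
    rw [key x, hk]

theorem affineFive_pow (t : ZMod 5) (n : ℕ) : affineFive t 0 ^ n = affineFive (n * t) 0 := by
  induction n with
  | zero => simp [affineFive_zero]
  | succ n ih => rw [pow_succ, ih, affineFive_mul]; congr 1; push_cast; ring

theorem affineFive_pow' (k n : ℕ) : affineFive 0 k ^ n = affineFive 0 (n * k) := by
  induction n with
  | zero => simp [affineFive_zero]
  | succ n ih => rw [pow_succ, ih, affineFive_mul]; congr 1; ring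

instance finite_affineFive : Finite (ZMod 5 ≃ᵃ[ZMod 5] ZMod 5) :=
  Finite.of_surjective _ affineFive_bijective.2

theorem card_affineFive : Nat.card (ZMod 5 ≃ᵃ[ZMod 5] ZMod 5) = 20 := by
  rw [← Nat.card_congr (Equiv.ofBijective _ affineFive_bijective)]
  simp

theorem isMetacyclicPair_affineFive :
    IsMetacyclicPair 5 4 2 0 (affineFive 1 0) (affineFive 0 1) where
  pow_left := by
    rw [affineFive_pow, ← affineFive_zero]; congr 1
  conj := by
    rw [mul_inv_eq_iff_eq_mul, affineFive_pow, affineFive_mul, affineFive_mul]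
    congr 1
  pow_right := by
    rw [affineFive_pow', affineFive_pow, affineFive_mod]
    simp
  closure_eq_top := by
    rw [eq_top_iff]
    rintro e -
    obtain ⟨⟨t, k⟩, rfl⟩ := affineFive_bijective.2 e
    have : affineFive t k = affineFive 1 0 ^ t.val * affineFive 0 1 ^ (k : ℕ) := by
      rw [affineFive_pow, affineFive_pow', affineFive_mul]; simp
    simp only [this]
    exact mul_mem (pow_mem (subset_closure (by simp)) _) (pow_mem (subset_closure (by simp)) _)
  card := card_affineFive

theorem strongStarFree_affineFive : StrongStarFree 5 (ZMod 5 ≃ᵃ[ZMod 5] ZMod 5) := by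
  rw [strongStarFree_iff]
  intro x hx
  obtain ⟨⟨t, k⟩, rfl⟩ := affineFive_bijective.2 x
  have key : ∀ (p q : ZMod 5 × Fin 4), affineFive q.1 q.2 * affineFive p.1 p.2 =
      affineFive p.1 p.2 * affineFive q.1 q.2 ↔
        q.1 + 2 ^ (q.2 : ℕ) * p.1 = p.1 + 2 ^ (p.2 : ℕ) * q.1 := by
    intro p q
    rw [affineFive_mul, affineFive_mul, add_comm (q.2 : ℕ)]
    refine ⟨fun h => ?_, fun h => by rw [h]⟩
    simpa using congrArg (fun e => e 0) h
  -- Commuting becomes an equation in `ZMod 5 × Fin 4`, which can be decided by enumeration.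
  have hcard : Nat.card (centralizer {affineFive t k}) =
      Nat.card {q : ZMod 5 × Fin 4 // q.1 + 2 ^ (q.2 : ℕ) * t = t + 2 ^ (k : ℕ) * q.1} := by
    refine (Nat.card_congr ((Equiv.ofBijective _ affineFive_bijective).subtypeEquiv ?_)).symm
    intro q
    rw [mem_centralizer_singleton_iff]
    exact (key (t, k) q).symm
  have hne : (t, k) ≠ (0, 0) := by
    intro h
    simp only [Prod.mk.injEq] at h
    apply hx
    simp [h.1, h.2, affineFive_zero, one_mem]
  rw [hcard, Nat.card_eq_fintype_card]
  have : ∀ p : ZMod 5 × Fin 4, p ≠ (0, 0) → Fintype.card {q : ZMod 5 × Fin 4 //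
      q.1 + 2 ^ (q.2 : ℕ) * p.1 = p.1 + 2 ^ (p.2 : ℕ) * q.1} ≤ 5 := by decide +kernel
  exact (this _ hne).trans (Nat.le_add_left _ _)

end Affine

/-! ### Star-freeness of the listed groups -/

section StarFree

/-- The centralizer of a noncentral element has index at least 2. The bound applies to all orders up
to 12, and to order 16 with center of order 4. -/
theorem strongStarFree_of_card_le {G : Type*} [Group G] [Finite G]
    (h : Nat.card G ≤ 2 * (Nat.card (center G) + 5)) : StrongStarFree 5 G := by
  rw [strongStarFree_iff]
  intro x hx
  have h1 : (centralizer {x}).index ≠ 1 := by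
    rw [Ne, index_eq_one]
    intro htop
    apply hx
    rw [mem_center_iff]
    intro g
    have : g ∈ centralizer {x} := htop ▸ mem_top g
    exact mem_centralizer_singleton_iff.1 this
  have h0 : (centralizer {x}).index ≠ 0 := index_ne_zero_of_finite
  have h2 := (centralizer {x}).index_mul_card
  have : 2 * Nat.card (centralizer {x}) ≤ (centralizer {x}).index * Nat.card (centralizer {x}) :=
    Nat.mul_le_mul_right _ (by omega)
  omega

theorem strongStarFree_specialLinearGroup :
    StrongStarFree 5 (Matrix.SpecialLinearGroup (Fin 2) (ZMod 3)) := by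
  -- The bound 6 suffices because the center has at least one element, so `|Z| + 5 ≥ 6`.
  have key : ∀ x : Matrix.SpecialLinearGroup (Fin 2) (ZMod 3), (∃ y, y * x ≠ x * y) →
      Fintype.card {y // y * x = x * y} ≤ 6 := by decide +kernel
  rw [strongStarFree_iff]
  intro x hx
  have hcard : Nat.card (centralizer {x}) = Nat.card {y // y * x = x * y} :=
    Nat.card_congr (Equiv.subtypeEquivRight fun y => mem_centralizer_singleton_iff)
  rw [hcard, Nat.card_eq_fintype_card]
  have : 0 < Nat.card (center (Matrix.SpecialLinearGroup (Fin 2) (ZMod 3))) := Nat.card_pos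
  have := key x (by simpa [mem_center_iff] using hx)
  omega

-- An element of prime order `p` is a product of disjoint `p`-cycles. Five points leave room for
-- only one if `p ≥ 3`, and for at most two transpositions, of which evenness requires exactly two.
open Equiv.Perm in
theorem Equiv.Perm.cycleType_eq_of_orderOf_eq {x : Equiv.Perm (Fin 5)} (hx : x.sign = 1)
    {p : ℕ} (hp : p.Prime) (hxp : orderOf x = p) :
    x.cycleType = Multiset.replicate (if p = 2 then 2 else 1) p := by
  obtain ⟨n, hn⟩ := cycleType_prime_order (hxp ▸ hp)
  have hsum := x.support.card_le_univ
  have hsign := hx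
  rw [sign_of_cycleType, hn, hxp] at hsign
  rw [← sum_cycleType, hn, hxp] at hsum
  simp only [Multiset.sum_replicate, smul_eq_mul, Fintype.card_fin,
    Multiset.card_replicate] at hsum hsign
  have h2 := hp.two_le
  rw [hn, hxp]
  congr 1
  split_ifs with h
  · subst h
    have : n < 2 := by omega
    interval_cases n
    · exact absurd hsign (by decide)
    · rfl
  · have : 3 ≤ p := by omega
    by_contra hne
    have : 2 ≤ n + 1 := by omega
    nlinarith

theorem strongStarFree_alternatingGroup : StrongStarFree 5 (alternatingGroup (Fin 5)) := by
  -- Centralizers are counted only for one representative of each nontrivial cycle type of even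
  -- permutations. Conjugation takes place in the full symmetric group, which normalizes the
  -- alternating group.
  have key : ∀ r ∈ [Equiv.swap 0 1 * Equiv.swap 2 3, Equiv.swap 0 1 * Equiv.swap 1 2, finRotate 5],
      Fintype.card {y : Equiv.Perm (Fin 5) // y * r = r * y ∧ y.sign = 1} ≤ 6 := by decide +kernel
  have hord : ∀ x : Equiv.Perm (Fin 5), x.sign = 1 → x ^ 2 = 1 ∨ x ^ 3 = 1 ∨ x ^ 5 = 1 := by
    decide +kernel
  have hrep : ∀ x : Equiv.Perm (Fin 5), x.sign = 1 → x ≠ 1 → ∃ r ∈ [Equiv.swap 0 1 * Equiv.swap 2 3,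
      Equiv.swap 0 1 * Equiv.swap 1 2, finRotate 5], IsConj x r := by
    intro x hx h1
    have aux : ∀ (p : ℕ) (r : Equiv.Perm (Fin 5)), p.Prime → x ^ p = 1 → r ^ p = 1 → r ≠ 1 →
        r.sign = 1 → IsConj x r := by
      intro p r hp hxp hrp hr hrs
      have : Fact p.Prime := ⟨hp⟩
      rw [Equiv.Perm.isConj_iff_cycleType_eq,
        Equiv.Perm.cycleType_eq_of_orderOf_eq hx hp (orderOf_eq_prime hxp h1),
        Equiv.Perm.cycleType_eq_of_orderOf_eq hrs hp (orderOf_eq_prime hrp hr)]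
    rcases hord x hx with h | h | h
    · exact ⟨_, by simp, aux 2 (Equiv.swap 0 1 * Equiv.swap 2 3) Nat.prime_two h
        (by decide) (by decide) (by decide)⟩
    · exact ⟨_, by simp, aux 3 (Equiv.swap 0 1 * Equiv.swap 1 2) Nat.prime_three h
        (by decide) (by decide) (by decide)⟩
    · exact ⟨_, by simp, aux 5 (finRotate 5) Nat.prime_five h
        (by decide) (by decide) (by decide)⟩
  rw [strongStarFree_iff]
  rintro ⟨x, hx⟩ hxc
  obtain ⟨r, hr, hconj⟩ := hrep x (Equiv.Perm.mem_alternatingGroup.1 hx) (by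
    rintro rfl
    exact hxc (one_mem _))
  obtain ⟨g, hg⟩ := isConj_iff.1 hconj
  have hcard : Nat.card (centralizer {(⟨x, hx⟩ : alternatingGroup (Fin 5))}) ≤
      Nat.card {y : Equiv.Perm (Fin 5) // y * r = r * y ∧ y.sign = 1} := by
    refine Nat.card_le_card_of_injective (fun y => ⟨g * y.1.1 * g⁻¹, ?_, ?_⟩) ?_
    · have := congrArg Subtype.val (mem_centralizer_singleton_iff.1 y.2)
      simp only [coe_mul] at this
      rw [← hg]
      calc g * y.1.1 * g⁻¹ * (g * x * g⁻¹) = g * (y.1.1 * x) * g⁻¹ := by group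
        _ = g * x * g⁻¹ * (g * y.1.1 * g⁻¹) := by rw [this]; group
    · have := Equiv.Perm.mem_alternatingGroup.1 y.1.2
      simp [this]
    · intro y z hyz
      have := Subtype.mk.inj hyz
      exact Subtype.ext (Subtype.ext (by simpa using this))
  have hpos : 0 < Nat.card (center (alternatingGroup (Fin 5))) := Nat.card_pos
  have := hcard.trans (Nat.card_eq_fintype_card.trans_le (key r hr))
  omega

end StarFree

/-! ### Presentations of the six groups of order 16 -/

/-- `G` has order `16`, is generated by `x`, `y` and the central elements `c`, `d`, and these
satisfy `c ^ p = d ^ q = 1`, `x ^ 2 = c ^ i`, `y ^ 2 = c ^ k * d ^ l`, `y x y⁻¹ = x c ^ m`. -/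
structure IsCentralQuadruple {G : Type*} [Group G] (p q m i k l : ℕ) (x y c d : G) : Prop where
  pow_left : c ^ p = 1
  pow_right : d ^ q = 1
  mem_center_left : c ∈ center G
  mem_center_right : d ∈ center G
  sq_left : x ^ 2 = c ^ i
  sq_right : y ^ 2 = c ^ k * d ^ l
  conj : y * x * y⁻¹ = x * c ^ m
  closure_eq_top : closure {y, x, d, c} = ⊤
  card : Nat.card G = 16

theorem IsCentralQuadruple.nonempty_mulEquiv {G H : Type*} [Group G] [Group H]
    [Finite G] [Finite H] {p q m i k l : ℕ} (hpq : p * q = 4) {x y c d : G} {x' y' c' d' : H}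
    (h : IsCentralQuadruple p q m i k l x y c d) (h' : IsCentralQuadruple p q m i k l x' y' c' d') :
    Nonempty (G ≃* H) := by
  have hp : 0 < p := Nat.pos_of_mul_pos_right (hpq ▸ four_pos)
  have hq : 0 < q := Nat.pos_of_mul_pos_left (hpq ▸ four_pos)
  refine nonempty_mulEquiv_of_closure {(y, y'), (x, x'), (d, d'), (c, c')} ?_ ?_ ?_
    (h.card.trans h'.card.symm)
  · simpa [Set.image_insert_eq] using h.closure_eq_top
  · simpa [Set.image_insert_eq] using h'.closure_eq_top
  · have hc : (c, c') ∈ center (G × H) := by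
      rw [mem_center_iff]
      exact fun g => Prod.ext (mem_center_iff.1 h.mem_center_left _)
        (mem_center_iff.1 h'.mem_center_left _)
    have hd : (d, d') ∈ center (G × H) := by
      rw [mem_center_iff]
      exact fun g => Prod.ext (mem_center_iff.1 h.mem_center_right _)
        (mem_center_iff.1 h'.mem_center_right _)
    have hconj : ∀ {z : G × H}, z ∈ center (G × H) → ∀ g, g * z * g⁻¹ = z := by
      intro z hz g
      rw [mem_center_iff.1 hz g, mul_inv_cancel_right]
    have h1 := card_closure_singleton_le (c, c') p hp (Prod.ext h.pow_left h'.pow_left)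
    have h2 := card_closure_insert_le {(c, c')} (d, d') q hq
      (by rw [show (d, d') ^ q = 1 from Prod.ext h.pow_right h'.pow_right]; exact one_mem _)
      (by rintro _ rfl; rw [hconj hc]; exact mem_closure_singleton_self _)
    have h3 := card_closure_insert_le {(d, d'), (c, c')} (x, x') 2 two_pos
      (by
        rw [show (x, x') ^ 2 = (c, c') ^ i from Prod.ext h.sq_left h'.sq_left]
        exact pow_mem (subset_closure (by simp)) _)
      (by
        rintro _ (rfl | rfl)
        · rw [hconj hd]; exact subset_closure (by simp)
        · rw [hconj hc]; exact subset_closure (by simp))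
    have h4 := card_closure_insert_le {(x, x'), (d, d'), (c, c')} (y, y') 2 two_pos
      (by
        rw [show (y, y') ^ 2 = (c, c') ^ k * (d, d') ^ l from Prod.ext h.sq_right h'.sq_right]
        exact mul_mem (pow_mem (subset_closure (by simp)) _) (pow_mem (subset_closure (by simp)) _))
      (by
        rintro _ (rfl | rfl | rfl)
        · rw [show (y, y') * (x, x') * (y, y')⁻¹ = (x, x') * (c, c') ^ m from
            Prod.ext h.conj h'.conj]
          exact mul_mem (subset_closure (by simp)) (pow_mem (subset_closure (by simp)) _)
        · rw [hconj hd]; exact subset_closure (by simp)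
        · rw [hconj hc]; exact subset_closure (by simp))
    rw [h.card]
    -- The central part has order at most `p * q = 4`, and `x`, `y` each at most double it.
    have h5 : q * Nat.card (closure {(c, c')}) ≤ q * p := Nat.mul_le_mul_left _ h1
    rw [mul_comm q p, hpq] at h5
    omega

theorem closure_quadruple_eq_top {G : Type*} [Group G] {p q : ℕ} {x y c d : G}
    (h : ∀ t : G, ∃ i j : Fin 2, ∃ k : Fin p, ∃ l : Fin q,
      t = x ^ (i : ℕ) * y ^ (j : ℕ) * c ^ (k : ℕ) * d ^ (l : ℕ)) :
    closure {y, x, d, c} = ⊤ := by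
  rw [eq_top_iff]
  rintro t -
  obtain ⟨i, j, k, l, rfl⟩ := h t
  exact mul_mem (mul_mem (mul_mem (pow_mem (subset_closure (by simp)) _)
    (pow_mem (subset_closure (by simp)) _)) (pow_mem (subset_closure (by simp)) _))
    (pow_mem (subset_closure (by simp)) _)

/-- The center is cyclic of order 4, generated by `c`, so the second central generator is trivial
and `q = 1`; the commutator is the involution `c ^ 2`. -/
theorem isCentralQuadruple_C4C2sdC2₂ :
    IsCentralQuadruple 4 1 2 0 0 0 (⟨(1, .ofAdd 1), 1⟩ : C4C2sdC2₂) ⟨1, .ofAdd 1⟩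
      ⟨(.ofAdd 1, 1), 1⟩ 1 where
  pow_left := by decide
  pow_right := by decide
  mem_center_left := by rw [mem_center_iff]; decide
  mem_center_right := one_mem _
  sq_left := by decide
  sq_right := by decide
  conj := by decide
  closure_eq_top := closure_quadruple_eq_top (p := 4) (q := 1) (by decide)
  card := by rw [Nat.card_eq_fintype_card]; decide

theorem isCentralQuadruple_C8sdC2 :
    IsCentralQuadruple 4 1 2 1 0 0 (⟨.ofAdd 1, 1⟩ : C8sdC2) ⟨1, .ofAdd 1⟩ ⟨.ofAdd 2, 1⟩ 1 where
  pow_left := by decide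
  pow_right := by decide
  mem_center_left := by rw [mem_center_iff]; decide
  mem_center_right := one_mem _
  sq_left := by decide
  sq_right := by decide
  conj := by decide
  closure_eq_top := closure_quadruple_eq_top (p := 4) (q := 1) (by decide)
  card := by rw [Nat.card_eq_fintype_card]; decide

/-- Two adjacent reflections serve as `x` and `y`, so that both squares are trivial and the
commutator is the central rotation. -/
theorem isCentralQuadruple_dihedralGroup_prod :
    IsCentralQuadruple 2 2 1 0 0 0 ((.sr 0, 1) : DihedralGroup 4 × Cyc 2) (.sr 1, 1) (.r 2, 1)
      (1, .ofAdd 1) where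
  pow_left := by decide
  pow_right := by decide
  mem_center_left := by rw [mem_center_iff]; decide
  mem_center_right := by rw [mem_center_iff]; decide
  sq_left := by decide
  sq_right := by decide
  conj := by decide
  closure_eq_top := closure_quadruple_eq_top (p := 2) (q := 2) (by decide)
  card := by rw [Nat.card_eq_fintype_card]; decide

theorem isCentralQuadruple_quaternionGroup_prod :
    IsCentralQuadruple 2 2 1 1 1 0 ((.a 1, 1) : QuaternionGroup 2 × Cyc 2) (.xa 0, 1) (.a 2, 1)
      (1, .ofAdd 1) where
  pow_left := by decide
  pow_right := by decide
  mem_center_left := by rw [mem_center_iff]; decide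
  mem_center_right := by rw [mem_center_iff]; decide
  sq_left := by decide
  sq_right := by decide
  conj := by decide
  closure_eq_top := closure_quadruple_eq_top (p := 2) (q := 2) (by decide)
  card := by rw [Nat.card_eq_fintype_card]; decide

theorem isCentralQuadruple_C4sdC4 :
    IsCentralQuadruple 2 2 1 1 0 1 (⟨.ofAdd 1, 1⟩ : C4sdC4) ⟨1, .ofAdd 1⟩ ⟨.ofAdd 2, 1⟩
      ⟨1, .ofAdd 2⟩ where
  pow_left := by decide
  pow_right := by decide
  mem_center_left := by rw [mem_center_iff]; decide
  mem_center_right := by rw [mem_center_iff]; decide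
  sq_left := by decide
  sq_right := by decide
  conj := by decide
  closure_eq_top := closure_quadruple_eq_top (p := 2) (q := 2) (by decide)
  card := by rw [Nat.card_eq_fintype_card]; decide

theorem isCentralQuadruple_C4C2sdC2₁ :
    IsCentralQuadruple 2 2 1 0 0 1 (⟨1, .ofAdd 1⟩ : C4C2sdC2₁) ⟨(.ofAdd 1, 1), 1⟩
      ⟨(1, .ofAdd 1), 1⟩ ⟨(.ofAdd 2, 1), 1⟩ where
  pow_left := by decide
  pow_right := by decide
  mem_center_left := by rw [mem_center_iff]; decide
  mem_center_right := by rw [mem_center_iff]; decide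
  sq_left := by decide
  sq_right := by decide
  conj := by decide
  closure_eq_top := closure_quadruple_eq_top (p := 2) (q := 2) (by decide)
  card := by rw [Nat.card_eq_fintype_card]; decide

theorem card_center_of_fintype {G : Type*} [Group G] [Fintype G] [DecidableEq G] {n : ℕ}
    (h : Fintype.card {x : G // ∀ y, y * x = x * y} = n) : Nat.card (center G) = n := by
  rw [← h, ← Nat.card_eq_fintype_card]
  exact Nat.card_congr (Equiv.subtypeEquivRight fun x => mem_center_iff)

theorem IsoToOneOfSix.card {G : Type*} [Group G] (h : IsoToOneOfSix G) :
    Nat.card G = 16 ∧ Nat.card (center G) = 4 := by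
  rcases h with ⟨⟨e⟩⟩ | ⟨⟨e⟩⟩ | ⟨⟨e⟩⟩ | ⟨⟨e⟩⟩ | ⟨⟨e⟩⟩ | ⟨⟨e⟩⟩ <;>
    rw [Nat.card_congr e.toEquiv, e.card_center]
  · exact ⟨isCentralQuadruple_C4C2sdC2₁.card, card_center_of_fintype (by decide +kernel)⟩
  · exact ⟨isCentralQuadruple_C4sdC4.card, card_center_of_fintype (by decide +kernel)⟩
  · exact ⟨isCentralQuadruple_C8sdC2.card, card_center_of_fintype (by decide +kernel)⟩
  · exact ⟨isCentralQuadruple_dihedralGroup_prod.card, card_center_of_fintype (by decide +kernel)⟩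
  · exact ⟨isCentralQuadruple_quaternionGroup_prod.card, card_center_of_fintype (by decide +kernel)⟩
  · exact ⟨isCentralQuadruple_C4C2sdC2₂.card, card_center_of_fintype (by decide +kernel)⟩

/-! ### Presentation of SL(2,3) -/

/-- `G` has order `24`, is generated by `x`, `y`, `w`, and these satisfy the relations of
`Q_8 ⋊ C_3`. -/
structure IsBinaryTetrahedralTriple {G : Type*} [Group G] (x y w : G) : Prop where
  pow_four : x ^ 4 = 1
  sq : y ^ 2 = x ^ 2
  conj : y * x * y⁻¹ = x ^ 3
  pow_three : w ^ 3 = 1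
  conj_left : w * x * w⁻¹ = y
  conj_right : w * y * w⁻¹ = x * y
  closure_eq_top : closure {w, y, x} = ⊤
  card : Nat.card G = 24

theorem IsBinaryTetrahedralTriple.nonempty_mulEquiv {G H : Type*} [Group G] [Group H]
    [Finite G] [Finite H] {x y w : G} {x' y' w' : H}
    (h : IsBinaryTetrahedralTriple x y w) (h' : IsBinaryTetrahedralTriple x' y' w') :
    Nonempty (G ≃* H) := by
  refine nonempty_mulEquiv_of_closure {(w, w'), (y, y'), (x, x')} ?_ ?_ ?_
    (h.card.trans h'.card.symm)
  · simpa [Set.image_insert_eq] using h.closure_eq_top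
  · simpa [Set.image_insert_eq] using h'.closure_eq_top
  · have h1 := card_closure_singleton_le (x, x') 4 four_pos (Prod.ext h.pow_four h'.pow_four)
    have h2 := card_closure_insert_le {(x, x')} (y, y') 2 two_pos
      (by
        rw [show (y, y') ^ 2 = (x, x') ^ 2 from Prod.ext h.sq h'.sq]
        exact pow_mem (subset_closure (by simp)) _)
      (by
        rintro _ rfl
        rw [show (y, y') * (x, x') * (y, y')⁻¹ = (x, x') ^ 3 from Prod.ext h.conj h'.conj]
        exact pow_mem (subset_closure (by simp)) _)
    have h3 := card_closure_insert_le {(y, y'), (x, x')} (w, w') 3 three_pos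
      (by
        rw [show (w, w') ^ 3 = 1 from Prod.ext h.pow_three h'.pow_three]
        exact one_mem _)
      (by
        rintro _ (rfl | rfl)
        · rw [show (w, w') * (y, y') * (w, w')⁻¹ = (x, x') * (y, y') from
            Prod.ext h.conj_right h'.conj_right]
          exact mul_mem (subset_closure (by simp)) (subset_closure (by simp))
        · rw [show (w, w') * (x, x') * (w, w')⁻¹ = (y, y') from
            Prod.ext h.conj_left h'.conj_left]
          exact subset_closure (by simp))
    rw [h.card]
    omega

open Matrix in
/-- A generating triple of `SL(2,3)`. -/
def sl23Gen : Fin 3 → SpecialLinearGroup (Fin 2) (ZMod 3) :=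
  ![⟨!![0, 2; 1, 0], by decide⟩, ⟨!![1, 1; 1, 2], by decide⟩, ⟨!![1, 1; 0, 1], by decide⟩]

theorem isBinaryTetrahedralTriple_specialLinearGroup :
    IsBinaryTetrahedralTriple (sl23Gen 0)
      (sl23Gen 1) (sl23Gen 2) where
  pow_four := by decide +kernel
  sq := by decide +kernel
  conj := by decide +kernel
  pow_three := by decide +kernel
  conj_left := by decide +kernel
  conj_right := by decide +kernel
  closure_eq_top := by
    rw [eq_top_iff]
    rintro t -
    have : ∀ t : Matrix.SpecialLinearGroup (Fin 2) (ZMod 3), ∃ i : Fin 3, ∃ j : Fin 2, ∃ k : Fin 4,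
        t = (sl23Gen 2) ^ (i : ℕ) * (sl23Gen 1) ^ (j : ℕ) *
          (sl23Gen 0) ^ (k : ℕ) := by
      decide +kernel
    obtain ⟨i, j, k, rfl⟩ := this t
    exact mul_mem (mul_mem (pow_mem (subset_closure (by simp)) _)
      (pow_mem (subset_closure (by simp)) _)) (pow_mem (subset_closure (by simp)) _)
  card := by rw [Nat.card_eq_fintype_card]; decide +kernel

/-! ### Tools: index-two cyclic subgroups, coset actions, large centralizers -/

section

variable {G : Type*} [Group G]

theorem conj_pow_eq_of_conj_eq {a b : G} {r : ℕ} (h : b * a * b⁻¹ = a ^ r) (k : ℕ) :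
    b ^ k * a * (b ^ k)⁻¹ = a ^ r ^ k := by
  induction k with
  | zero => simp
  | succ k ih =>
    calc b ^ (k + 1) * a * (b ^ (k + 1))⁻¹ = b * (b ^ k * a * (b ^ k)⁻¹) * b⁻¹ := by group
      _ = (b * a * b⁻¹) ^ r ^ k := by rw [ih, conj_pow]
      _ = a ^ r ^ (k + 1) := by rw [h, ← pow_mul, pow_succ']

theorem commute_of_closure_pair_eq_top {a b : G} (h : closure {b, a} = ⊤) (hab : Commute a b) :
    ∀ x y : G, x * y = y * x := by
  have hc : ∀ z : G, Commute z a → Commute z b → z ∈ center G := by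
    intro z hza hzb
    have : closure {b, a} ≤ centralizer {z} := by
      rw [closure_le]
      rintro _ (rfl | rfl)
      · exact mem_centralizer_singleton_iff.2 hzb.symm
      · exact mem_centralizer_singleton_iff.2 hza.symm
    rw [h] at this
    rw [mem_center_iff]
    exact fun g => mem_centralizer_singleton_iff.1 (this (mem_top g))
  have : closure {b, a} ≤ center G := by
    rw [closure_le]
    rintro _ (rfl | rfl)
    · exact hc _ hab.symm (Commute.refl _)
    · exact hc _ (Commute.refl _) hab
  rw [h] at this
  intro x y
  exact (mem_center_iff.1 (this (mem_top x)) y).symm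

/-- The subgroup generated by `a` has index 2, hence is normal and contains `b ^ 2` for any `b`
outside it. The congruences on `r` and `s` say that `b` does not commute with `a`, that `b ^ 2`
does, and that `b` commutes with its own square. For the small `n` needed later they leave at most
two presentations. -/
theorem exists_isMetacyclicPair_two [Finite G] (hG : ∃ x y : G, x * y ≠ y * x) {n : ℕ} {a : G}
    (ha : orderOf a = n) (hcard : Nat.card G = 2 * n) :
    ∃ b r s, r < n ∧ s < n ∧ r % n ≠ 1 % n ∧ r ^ 2 % n = 1 % n ∧ r * s % n = s % n ∧
      IsMetacyclicPair n 2 r s a b := by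
  have hn : 0 < n := ha ▸ orderOf_pos a
  have hz : Nat.card (zpowers a) = n := by rw [Nat.card_zpowers, ha]
  have hidx : (zpowers a).index = 2 := by
    have := (zpowers a).index_mul_card
    rw [hz, hcard] at this
    exact Nat.eq_of_mul_eq_mul_right hn this
  have hnorm := normal_of_index_eq_two hidx
  obtain ⟨b, hb⟩ : ∃ b, b ∉ zpowers a := by
    by_contra! hall
    have : zpowers a = ⊤ := (eq_top_iff' _).2 hall
    rw [this, index_top] at hidx
    omega
  have hpow : ∀ g ∈ zpowers a, ∃ k < n, a ^ k = g := by
    classical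
    intro g hg
    rw [mem_zpowers_iff_mem_range_orderOf, ha] at hg
    simpa using hg
  obtain ⟨r, hr, hconj⟩ := hpow _ (hnorm.conj_mem a (mem_zpowers a) b)
  obtain ⟨s, hs, hsq⟩ := hpow _ (sq_mem_of_index_two hidx b)
  have htop : closure {b, a} = ⊤ := by
    have hle : zpowers a ≤ closure {b, a} := by
      rw [zpowers_le]; exact subset_closure (by simp)
    have hdvd := index_dvd_of_le hle
    rw [hidx, Nat.dvd_prime Nat.prime_two] at hdvd
    rcases hdvd with h | h
    · exact index_eq_one.1 h
    · exfalso
      have h1 := (closure {b, a}).index_mul_card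
      have h2 := (zpowers a).index_mul_card
      rw [hidx] at h2
      rw [h] at h1
      have := eq_of_le_of_card_ge hle (by omega)
      exact hb (this ▸ subset_closure (by simp))
  have hmod : ∀ {i j : ℕ}, a ^ i = a ^ j → i % n = j % n := by
    intro i j h
    have := pow_eq_pow_iff_modEq.1 h
    rwa [ha] at this
  refine ⟨b, r, s, hr, hs, ?_, ?_, ?_, ?_, hconj.symm, hsq.symm, htop, hcard⟩
  · intro h
    obtain ⟨x, y, hxy⟩ := hG
    have hr1 : a ^ r = a := by
      have := (pow_eq_pow_iff_modEq (x := a) (n := r) (m := 1)).2 (by rw [ha]; exact h)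
      simpa using this
    rw [hr1] at hconj
    exact hxy (commute_of_closure_pair_eq_top htop (eq_mul_inv_iff_mul_eq.1 hconj) x y)
  · apply hmod
    rw [pow_one, ← conj_pow_eq_of_conj_eq hconj.symm 2, ← hsq]
    group
  · apply hmod
    rw [pow_mul, hconj, conj_pow, hsq]
    group
  · rw [← ha, pow_orderOf_eq_one]

/-- The action on the cosets of `H` is faithful, and the alternating group is the only subgroup of
index 2 in the symmetric group. -/
theorem nonempty_mulEquiv_alternatingGroup [Finite G] {n : ℕ} (H : Subgroup G)
    (hi : H.index = n) (hcore : H.normalCore = ⊥) (hcard : 2 * Nat.card G = n.factorial) :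
    Nonempty (G ≃* alternatingGroup (Fin n)) := by
  have hinj : Function.Injective (MulAction.toPermHom G (G ⧸ H)) := by
    rw [← MonoidHom.ker_eq_bot_iff, ← normalCore_eq_ker, hcore]
  have e : G ⧸ H ≃ Fin n := Finite.equivFinOfCardEq hi
  let ψ : G →* Equiv.Perm (Fin n) :=
    e.permCongrHom.toMonoidHom.comp (MulAction.toPermHom G (G ⧸ H))
  have hψ : Function.Injective ψ := e.permCongrHom.injective.comp hinj
  have hr : Nat.card ψ.range = Nat.card G :=
    (Nat.card_congr (MonoidHom.ofInjective hψ).toEquiv).symm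
  have hidx : ψ.range.index = 2 := by
    have h1 := ψ.range.index_mul_card
    rw [hr, Nat.card_eq_fintype_card (α := Equiv.Perm (Fin n)), Fintype.card_perm,
      Fintype.card_fin, ← hcard] at h1
    exact Nat.eq_of_mul_eq_mul_right Nat.card_pos h1
  have := Equiv.Perm.eq_alternatingGroup_of_index_eq_two hidx
  exact ⟨(MonoidHom.ofInjective hψ).trans (MulEquiv.subgroupCongr this)⟩

theorem card_le_mul_card_sub_one_of_normal [Finite G] {K : Subgroup G} (hK : K.Normal) {x : G}
    (hx : x ∈ K) (h1 : x ≠ 1) :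
    Nat.card G ≤ Nat.card (centralizer {x}) * (Nat.card K - 1) := by
  have h := card_le_of_conj_mem (x := x) (S := (K : Set G) \ {1}) (by
    intro g
    refine ⟨hK.conj_mem x hx g, ?_⟩
    simpa using h1)
  rwa [Set.ncard_sdiff_singleton_of_mem (one_mem K), ← Nat.card_coe_set_eq] at h

theorem orderOf_eq_pow_of_isPGroup {Q : Subgroup G} {p : ℕ} (hQ : IsPGroup p Q) {x : G}
    (hx : x ∈ Q) : ∃ j, orderOf x ∣ p ^ j := by
  obtain ⟨j, hj⟩ := hQ ⟨x, hx⟩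
  exact ⟨j, orderOf_dvd_of_pow_eq_one (congrArg Subtype.val hj)⟩

/-- Take a nontrivial central element of a subgroup of order `p ^ k`. Its order is a power of `p`,
so it is not central in `G`, and its centralizer contains two subgroups of coprime orders: that one
and the center. -/
theorem exists_pow_mul_card_center_dvd_card_centralizer [Finite G] {p k : ℕ} (hp : p.Prime)
    (hk : k ≠ 0) (hdvd : p ^ k ∣ Nat.card G) (hpz : ¬ p ∣ Nat.card (center G)) :
    ∃ x ∉ center G, p ^ k * Nat.card (center G) ∣ Nat.card (centralizer {x}) := by
  have : Fact p.Prime := ⟨hp⟩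
  obtain ⟨Q, hQ⟩ := Sylow.exists_subgroup_card_pow_prime p hdvd
  have hpg : IsPGroup p Q := IsPGroup.of_card hQ
  have hnt : Nontrivial Q := by
    rw [← Finite.one_lt_card_iff_nontrivial, hQ]
    exact Nat.one_lt_pow hk hp.one_lt
  have := hpg.center_nontrivial
  obtain ⟨⟨x, hxc⟩, hx1⟩ := exists_ne (1 : center Q)
  have hx1' : (x : G) ≠ 1 := fun h => hx1 (Subtype.ext (Subtype.ext h))
  refine ⟨x, fun hc => hpz ?_, ?_⟩
  · obtain ⟨j, hj⟩ := orderOf_eq_pow_of_isPGroup hpg x.2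
    obtain ⟨i, -, hi⟩ := (Nat.dvd_prime_pow hp).1 hj
    have hi0 : i ≠ 0 := by
      rintro rfl
      exact hx1' (orderOf_eq_one_iff.1 hi)
    have := orderOf_dvd_natCard (⟨x, hc⟩ : center G)
    rw [orderOf_mk, hi] at this
    exact (dvd_pow_self p hi0).trans this
  · apply Nat.Coprime.mul_dvd_of_dvd_of_dvd
    · exact Nat.Coprime.pow_left k ((Nat.Prime.coprime_iff_not_dvd hp).2 hpz)
    · rw [← hQ]
      apply card_dvd_of_le
      intro g hg
      exact mem_centralizer_singleton_iff.2
        (congrArg Subtype.val (mem_center_iff.1 hxc ⟨g, hg⟩))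
    · exact card_dvd_of_le (center_le_centralizer _)

/-- A subgroup of order `p ^ 2` is abelian and too large to lie in the center. -/
theorem exists_sq_dvd_card_centralizer [Finite G] {p : ℕ} (hp : p.Prime)
    (hdvd : p ^ 2 ∣ Nat.card G) (hz : Nat.card (center G) < p ^ 2) :
    ∃ x ∉ center G, p ^ 2 ∣ Nat.card (centralizer {x}) := by
  have : Fact p.Prime := ⟨hp⟩
  obtain ⟨Q, hQ⟩ := Sylow.exists_subgroup_card_pow_prime p hdvd
  have hcomm := IsPGroup.isMulCommutative_of_card_eq_prime_sq hQ
  obtain ⟨x, hxQ, hxc⟩ : ∃ x ∈ Q, x ∉ center G := by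
    by_contra! hle
    have := card_le_of_le (show Q ≤ center G from hle)
    omega
  refine ⟨x, hxc, ?_⟩
  rw [← hQ]
  apply card_dvd_of_le
  intro g hg
  exact mem_centralizer_singleton_iff.2 (congrArg Subtype.val (mul_comm' (⟨g, hg⟩ : Q) ⟨x, hxQ⟩))

/-- In a nonabelian `p`-group some noncentral element has a conjugacy class no larger than the
center. -/
theorem IsPGroup.exists_card_le_mul_card_center [Finite G] {p : ℕ} [Fact p.Prime]
    (hG : IsPGroup p G) (hz : center G ≠ ⊤) :
    ∃ x ∉ center G, Nat.card G ≤ Nat.card (centralizer {x}) * Nat.card (center G) := by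
  have hq : IsPGroup p (G ⧸ center G) := hG.to_quotient _
  have hnt : Nontrivial (G ⧸ center G) := by
    rw [← Finite.one_lt_card_iff_nontrivial]
    have h0 : (center G).index ≠ 0 := index_ne_zero_of_finite
    have h1 : (center G).index ≠ 1 := fun h => hz (index_eq_one.1 h)
    change 1 < (center G).index
    omega
  have := hq.center_nontrivial
  obtain ⟨⟨q, hqc⟩, hq1⟩ := exists_ne (1 : center (G ⧸ center G))
  obtain ⟨x, rfl⟩ := QuotientGroup.mk_surjective q
  refine ⟨x, fun hx => hq1 (Subtype.ext ((QuotientGroup.eq_one_iff x).2 hx)), ?_⟩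
  -- The image of `x` is central modulo the center, so all conjugates of `x` lie in one coset of the
  -- center.
  have h := card_le_of_conj_mem (x := x) (S := (fun z => z * x) '' (center G : Set G)) (by
    intro g
    refine ⟨g * x * g⁻¹ * x⁻¹, ?_, by group⟩
    rw [SetLike.mem_coe, ← QuotientGroup.eq_one_iff]
    have := mem_center_iff.1 hqc (g : G ⧸ center G)
    simp only [QuotientGroup.mk_mul, QuotientGroup.mk_inv]
    rw [this]
    group)
  rwa [Set.ncard_image_of_injective _ (mul_left_injective x), ← Nat.card_coe_set_eq] at h

end

theorem orderOf_dvd_card_centralizer {G : Type*} [Group G] {x g : G} (h : g * x = x * g) :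
    orderOf g ∣ Nat.card (centralizer {x}) := by
  have := orderOf_dvd_natCard (⟨g, mem_centralizer_singleton_iff.2 h⟩ : centralizer {x})
  rwa [orderOf_mk] at this

/-! ### Trivial center -/

section

variable {G : Type*} [Group G] [Finite G]

/-- The subgroup of order 5 has the smallest prime index 3, hence is normal. An element of order 3
acts on it by an exponent `r` with `r ^ 3 ≡ 1` modulo 5, which forces `r = 1`. -/
theorem exists_three_mul_five_dvd_centralizer_of_card_eq_fifteen (K : Subgroup G)
    (hK : Nat.card K = 15) : ∃ x : G, x ≠ 1 ∧ 15 ∣ Nat.card (centralizer {x}) := by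
  have : Fact (Nat.Prime 5) := ⟨Nat.prime_five⟩
  have : Fact (Nat.Prime 3) := ⟨Nat.prime_three⟩
  obtain ⟨a, ha⟩ := exists_prime_orderOf_dvd_card' (G := K) 5 (by rw [hK]; norm_num)
  obtain ⟨b, hb⟩ := exists_prime_orderOf_dvd_card' (G := K) 3 (by rw [hK]; norm_num)
  have hidx : (zpowers a).index = 3 := by
    have := (zpowers a).index_mul_card
    rw [Nat.card_zpowers, ha, hK] at this
    omega
  have hn : (zpowers a).Normal := normal_of_index_eq_minFac_card (by rw [hidx, hK]; norm_num)
  classical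
  have hmem := hn.conj_mem a (mem_zpowers a) b
  rw [mem_zpowers_iff_mem_range_orderOf, ha] at hmem
  simp only [Finset.mem_image, Finset.mem_range] at hmem
  obtain ⟨r, hr, hconj⟩ := hmem
  have h3 := conj_pow_eq_of_conj_eq hconj.symm 3
  rw [← hb, pow_orderOf_eq_one, hb] at h3
  have h4 : a ^ 1 = a ^ r ^ 3 := by simpa using h3
  have h5 := pow_eq_pow_iff_modEq.1 h4
  rw [ha, Nat.ModEq] at h5
  have hr1 : r = 1 := by
    interval_cases r <;> first | rfl | exact absurd h5 (by decide)
  rw [hr1, pow_one] at hconj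
  have hcomm : b * a = a * b := (eq_mul_inv_iff_mul_eq.1 hconj).symm
  have hcomm' : (b : G) * a = a * b := congrArg Subtype.val hcomm
  refine ⟨a, fun h => ?_, ?_⟩
  · have : a = 1 := Subtype.ext h
    rw [this, orderOf_one] at ha
    omega
  · have h1 := orderOf_dvd_card_centralizer hcomm'
    have h2 := orderOf_dvd_card_centralizer (x := (a : G)) (g := a) rfl
    rw [orderOf_coe] at h1 h2
    rw [ha] at h2
    rw [hb] at h1
    exact Nat.Coprime.mul_dvd_of_dvd_of_dvd (by norm_num : Nat.Coprime 3 5) h1 h2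

/-- An involution lies in a subgroup of order 4, which is abelian. -/
theorem four_dvd_card_centralizer (h4 : 4 ∣ Nat.card G) {t : G} (ht : orderOf t = 2) :
    4 ∣ Nat.card (centralizer {t}) := by
  have : Fact (Nat.Prime 2) := ⟨Nat.prime_two⟩
  obtain ⟨K, hK, hle⟩ := Sylow.exists_subgroup_card_pow_prime_le 2 (n := 1) (m := 2) h4 (zpowers t)
    (by rw [Nat.card_zpowers, ht, pow_one]) (by norm_num)
  have hcomm := IsPGroup.isMulCommutative_of_card_eq_prime_sq hK
  change 2 ^ 2 ∣ _
  rw [← hK]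
  apply card_dvd_of_le
  intro g hg
  exact mem_centralizer_singleton_iff.2
    (congrArg Subtype.val (mul_comm' (⟨g, hg⟩ : K) ⟨t, hle (mem_zpowers t)⟩))

/-- A nontrivial element of the core would have at least `|G| / m` conjugates, all nontrivial and in
`H`. -/
theorem normalCore_eq_bot_of_card_lt {m : ℕ} (hC : ∀ x : G, x ≠ 1 → Nat.card (centralizer {x}) ≤ m)
    {H : Subgroup G} (hH : m * (Nat.card H - 1) < Nat.card G) : H.normalCore = ⊥ := by
  rw [eq_bot_iff]
  intro x hx
  by_contra h1
  have h2 := card_le_mul_card_sub_one_of_normal (normalCore_normal H) hx h1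
  have h3 := card_le_of_le (normalCore_le H)
  have h4 : Nat.card (centralizer {x}) * (Nat.card H.normalCore - 1) ≤ m * (Nat.card H - 1) :=
    Nat.mul_le_mul (hC x h1) (by omega)
  omega

variable (hC : ∀ x : G, x ≠ 1 → Nat.card (centralizer {x}) ≤ 6)
include hC

theorem card_dvd_sixty (hz : Nat.card (center G) = 1) : Nat.card G ∣ 60 := by
  rw [Nat.dvd_iff_prime_pow_dvd_dvd]
  intro p k hp hdvd
  rcases eq_or_ne k 0 with rfl | hk
  · simp
  obtain ⟨x, hx, hxd⟩ := exists_pow_mul_card_center_dvd_card_centralizer hp hk hdvd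
    (by rw [hz]; exact hp.one_lt.ne' ∘ Nat.dvd_one.1)
  have h6 := hC x (by rintro rfl; exact hx (one_mem _))
  rw [hz, mul_one] at hxd
  have hle := (Nat.le_of_dvd Nat.card_pos hxd).trans h6
  generalize hq : p ^ k = q at *
  have hq0 : q ≠ 0 := by
    rw [← hq]; exact pow_ne_zero _ hp.ne_zero
  -- Of the numbers from 1 to 6 all divide 60, but 6 is not a prime power; dropping it leaves the
  -- possible orders at most 5.
  have hq6 : q ≠ 6 := by
    rintro rfl
    have h2 := (Nat.prime_dvd_prime_iff_eq Nat.prime_two hp).1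
      (Nat.prime_two.dvd_of_dvd_pow (show 2 ∣ p ^ k by rw [hq]; norm_num))
    have h3 := (Nat.prime_dvd_prime_iff_eq Nat.prime_three hp).1
      (Nat.prime_three.dvd_of_dvd_pow (show 3 ∣ p ^ k by rw [hq]; norm_num))
    omega
  interval_cases q <;> omega

theorem card_ne_fifteen : Nat.card G ≠ 15 := by
  intro h
  obtain ⟨x, hx, h15⟩ := exists_three_mul_five_dvd_centralizer_of_card_eq_fifteen (⊤ : Subgroup G)
    (by rw [card_top, h])
  have := Nat.le_of_dvd Nat.card_pos h15
  have := hC x hx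
  omega

theorem card_ne_thirty : Nat.card G ≠ 30 := by
  intro h
  have : Fact (Nat.Prime 2) := ⟨Nat.prime_two⟩
  obtain ⟨P⟩ : Nonempty (Sylow 2 G) := inferInstance
  have hP : Nat.card P = 2 := by
    have hf : Nat.factorization 30 2 = 1 := by
      rw [Nat.factorization_def _ Nat.prime_two]
      decide +kernel
    rw [P.card_eq_multiplicity, h, hf, pow_one]
  have hcyc : IsCyclic P := isCyclic_of_prime_card (p := 2) hP
  -- A cyclic Sylow subgroup for the smallest prime has a normal complement, here of order 15.
  have hcompl := hcyc.isComplement' (G := G) (by rw [h]; norm_num)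
  have := hcompl.card_mul_card
  rw [hP] at this
  obtain ⟨x, hx, h15⟩ := exists_three_mul_five_dvd_centralizer_of_card_eq_fifteen _
    (show Nat.card (MonoidHom.transferSylow P _).ker = 15 by omega)
  have := Nat.le_of_dvd Nat.card_pos h15
  have := hC x hx
  omega

/-- If the centralizer of `x` had order 6, it would contain an involution `t`, whose own centralizer
has order divisible by 4 and hence equal to 4. As it contains `x`, the order of `x` divides both 6
and 4, so `x` is an involution and 4 divides 6. -/
theorem card_centralizer_le_five (h4 : 4 ∣ Nat.card G) (x : G) (hx : x ≠ 1) :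
    Nat.card (centralizer {x}) ≤ 5 := by
  have : Fact (Nat.Prime 2) := ⟨Nat.prime_two⟩
  by_contra! hlt
  have h6 : Nat.card (centralizer {x}) = 6 := le_antisymm (hC x hx) hlt
  have hord : orderOf x ∣ 6 := h6 ▸ orderOf_dvd_card_centralizer rfl
  have hord1 : orderOf x ≠ 1 := fun h => hx (orderOf_eq_one_iff.1 h)
  obtain ⟨⟨t, htx⟩, ht⟩ := exists_prime_orderOf_dvd_card' (G := centralizer {x}) 2
    (by rw [h6]; norm_num)
  rw [orderOf_mk] at ht
  have htd := four_dvd_card_centralizer h4 ht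
  have ht1 : t ≠ 1 := by
    rintro rfl
    rw [orderOf_one] at ht
    omega
  have htC := hC t ht1
  have hpos : 0 < Nat.card (centralizer {t}) := Nat.card_pos
  have hxt : orderOf x ∣ Nat.card (centralizer {t}) :=
    orderOf_dvd_card_centralizer (mem_centralizer_singleton_iff.1 htx).symm
  have h44 : Nat.card (centralizer {t}) = 4 := by omega
  have h2 : orderOf x ∣ 2 := by
    have := Nat.dvd_gcd hord (h44 ▸ hxt)
    exact this
  have h22 : orderOf x = 2 := (Nat.dvd_prime Nat.prime_two).1 h2 |>.resolve_left hord1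
  have := four_dvd_card_centralizer h4 h22
  omega

theorem nonempty_mulEquiv_alternatingGroup_four (h : Nat.card G = 12) :
    Nonempty (G ≃* alternatingGroup (Fin 4)) := by
  have : Fact (Nat.Prime 3) := ⟨Nat.prime_three⟩
  have h5 := card_centralizer_le_five hC (by rw [h]; norm_num)
  obtain ⟨a, ha⟩ := exists_prime_orderOf_dvd_card' (G := G) 3 (by rw [h]; norm_num)
  have ha' : Nat.card (zpowers a) = 3 := by rw [Nat.card_zpowers, ha]
  have hidx := (zpowers a).index_mul_card
  rw [ha', h] at hidx
  -- The core is trivial because `5 * (3 - 1) < 12`.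
  refine nonempty_mulEquiv_alternatingGroup (zpowers a) (by omega)
    (normalCore_eq_bot_of_card_lt h5 (by omega)) ?_
  rw [h]
  rfl

theorem nonempty_mulEquiv_alternatingGroup_five (h : Nat.card G = 60) :
    Nonempty (G ≃* alternatingGroup (Fin 5)) := by
  have : Fact (Nat.Prime 2) := ⟨Nat.prime_two⟩
  have h5 := card_centralizer_le_five hC (by rw [h]; norm_num)
  obtain ⟨P⟩ : Nonempty (Sylow 2 G) := inferInstance
  have hP : Nat.card P = 4 := by
    have hf : Nat.factorization 60 2 = 2 := by
      rw [Nat.factorization_def _ Nat.prime_two]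
      decide +kernel
    rw [P.card_eq_multiplicity, h, hf]
    norm_num
  have hcomm : IsMulCommutative P := IsPGroup.isMulCommutative_of_card_eq_prime_sq (p := 2) hP
  have hN60 : Nat.card (normalizer (P : Set G)) ∣ 60 := h ▸ card_subgroup_dvd_card _
  have hPN : (P : Subgroup G) ≤ normalizer (P : Set G) := le_normalizer
  have hN4 : 4 ∣ Nat.card (normalizer (P : Set G)) := hP ▸ card_dvd_of_le hPN
  obtain ⟨x, hxP, hx1⟩ : ∃ x ∈ (P : Subgroup G), x ≠ 1 := by
    have : Nontrivial P := by
      rw [← Finite.one_lt_card_iff_nontrivial]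
      exact hP ▸ (by norm_num)
    obtain ⟨y, hy⟩ := exists_ne (1 : P)
    exact ⟨y, y.2, fun h => hy (Subtype.ext h)⟩
  -- Inside its normalizer, `P` has only 3 nontrivial elements, so a conjugacy class has size at
  -- most 3 against a centralizer of order at most 5.
  have hN15 : Nat.card (normalizer (P : Set G)) ≤ 15 := by
    have h1 := card_le_mul_card_sub_one_of_normal
      (K := (P : Subgroup G).subgroupOf (normalizer (P : Set G))) normal_in_normalizer
      (x := ⟨x, hPN hxP⟩) (mem_subgroupOf.2 hxP) (fun h => hx1 (congrArg Subtype.val h))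
    have h2 : Nat.card ((P : Subgroup G).subgroupOf (normalizer (P : Set G))) = 4 := by
      rw [Nat.card_congr (subgroupOfEquivOfLe hPN).toEquiv, hP]
    have h3 : Nat.card (centralizer {(⟨x, hPN hxP⟩ : normalizer (P : Set G))}) ≤
        Nat.card (centralizer {x}) := by
      refine Nat.card_le_card_of_injective (fun g => ⟨g.1.1, ?_⟩) ?_
      · exact mem_centralizer_singleton_iff.2
          (congrArg Subtype.val (mem_centralizer_singleton_iff.1 g.2))
      · intro g k hgk
        exact Subtype.ext (Subtype.ext (Subtype.mk.inj hgk))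
    have h4 := h5 x hx1
    rw [h2] at h1
    omega
  have hN : Nat.card (normalizer (P : Set G)) = 12 := by
    have hcases : Nat.card (normalizer (P : Set G)) = 4 ∨
        Nat.card (normalizer (P : Set G)) = 12 := by
      generalize Nat.card (normalizer (P : Set G)) = n at *
      interval_cases n <;> omega
    -- If `P` were its own normalizer, Burnside's transfer theorem would give a normal complement of
    -- order 15.
    refine hcases.resolve_left fun h4 => ?_
    have heq := eq_of_le_of_card_ge hPN (h4.trans hP.symm).le
    have hle : normalizer (P : Set G) ≤ centralizer (P : Set G) := by
      rw [← heq]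
      exact le_centralizer_iff_isMulCommutative.2 hcomm
    have hcompl := MonoidHom.ker_transferSylow_isComplement' P hle
    have := hcompl.card_mul_card
    rw [hP] at this
    obtain ⟨x, hx, h15⟩ := exists_three_mul_five_dvd_centralizer_of_card_eq_fifteen _
      (show Nat.card (MonoidHom.transferSylow P hle).ker = 15 by omega)
    have := Nat.le_of_dvd Nat.card_pos h15
    have := hC x hx
    omega
  have hidx := (normalizer (P : Set G)).index_mul_card
  rw [hN, h] at hidx
  refine nonempty_mulEquiv_alternatingGroup (normalizer (P : Set G)) (by omega)
    (normalCore_eq_bot_of_card_lt h5 (by rw [hN, h]; norm_num)) ?_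
  rw [h]
  rfl

theorem exists_isMetacyclicPair_of_card_eq_twenty (h : Nat.card G = 20) :
    ∃ a b : G, IsMetacyclicPair 5 4 2 0 a b := by
  have : Fact (Nat.Prime 5) := ⟨Nat.prime_five⟩
  have h5 := card_centralizer_le_five hC (by rw [h]; norm_num)
  obtain ⟨P⟩ : Nonempty (Sylow 5 G) := inferInstance
  have hP : Nat.card P = 5 := by
    have hf : Nat.factorization 20 5 = 1 := by
      rw [Nat.factorization_def _ Nat.prime_five]
      decide +kernel
    rw [P.card_eq_multiplicity, h, hf, pow_one]
  have hPn : (P : Subgroup G).Normal := by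
    have h1 := P.card_dvd_index
    have h2 := card_sylow_modEq_one 5 G
    have h3 := (P : Subgroup G).index_mul_card
    have h4 : (P : Subgroup G).index = 4 := by
      rw [hP, h] at h3
      omega
    rw [h4] at h1
    have h6 := Nat.le_of_dvd four_pos h1
    have h7 : Nat.card (Sylow 5 G) = 1 := by
      rw [Nat.ModEq] at h2
      omega
    have := (Nat.card_eq_one_iff_unique.1 h7).1
    infer_instance
  obtain ⟨⟨a, haP⟩, ha⟩ := exists_prime_orderOf_dvd_card' (G := P) 5 (by rw [hP])
  rw [orderOf_mk] at ha
  have ha1 : a ≠ 1 := by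
    rintro rfl
    rw [orderOf_one] at ha
    omega
  have hz : Nat.card (zpowers a) = 5 := by rw [Nat.card_zpowers, ha]
  have hPz : zpowers a = P := eq_of_le_of_card_ge ((zpowers_le).2 haP) (by rw [hz]; exact hP.le)
  have hCz : zpowers a = centralizer {a} := by
    apply eq_of_le_of_card_ge
    · rw [zpowers_le, mem_centralizer_singleton_iff]
    · rw [hz]; exact h5 a ha1
  have hconj : ∀ g, g * a * g⁻¹ ∈ zpowers a := by
    rw [hPz]
    exact hPn.conj_mem a haP
  have hmod : ∀ {i j : ℕ}, a ^ i = a ^ j → i % 5 = j % 5 := by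
    intro i j h
    have := pow_eq_pow_iff_modEq.1 h
    rwa [ha] at this
  classical
  -- Otherwise `a` has at most three conjugates, and `|G| ≤ 5 * 3`.
  obtain ⟨b, hb⟩ : ∃ b, b * a * b⁻¹ = a ^ 2 := by
    by_contra! hne
    have h1 := card_le_of_conj_mem (x := a) (S := (({a, a ^ 3, a ^ 4} : Finset G) : Set G)) (by
      intro g
      have hg := hconj g
      rw [mem_zpowers_iff_mem_range_orderOf, ha] at hg
      simp only [Finset.mem_image, Finset.mem_range] at hg
      obtain ⟨k, hk, hg⟩ := hg
      have hk0 : k ≠ 0 := by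
        rintro rfl
        rw [pow_zero, eq_comm, conj_eq_one_iff] at hg
        exact ha1 hg
      have hk2 : k ≠ 2 := by
        rintro rfl
        exact hne g hg.symm
      rw [← hg]
      have : k = 1 ∨ k = 3 ∨ k = 4 := by omega
      rcases this with rfl | rfl | rfl <;> simp)
    rw [Set.ncard_coe_finset] at h1
    have h2 : ({a, a ^ 3, a ^ 4} : Finset G).card ≤ 3 := Finset.card_le_three
    have h3 := Nat.mul_le_mul (h5 a ha1) h2
    omega
  -- As `2 ^ 4 ≡ 1` modulo 5, `b ^ 4` centralizes `a` and so is a power of `a`. Conjugation by `b`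
  -- fixes it and also squares it, so it is trivial.
  have hb4 : b ^ 4 = 1 := by
    have h1 : b ^ 4 ∈ zpowers a := by
      have h2 := conj_pow_eq_of_conj_eq hb 4
      have h3 : a ^ 2 ^ 4 = a := by
        have := (pow_eq_pow_iff_modEq (x := a) (n := 2 ^ 4) (m := 1)).2 (by rw [ha]; decide)
        rwa [pow_one] at this
      rw [h3, mul_inv_eq_iff_eq_mul] at h2
      rw [hCz, mem_centralizer_singleton_iff, h2]
    obtain ⟨s, hs⟩ := h1
    simp only at hs
    have h2 : b * a ^ s * b⁻¹ = a ^ s := by rw [hs]; group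
    rw [← conj_zpow, hb, ← zpow_natCast, zpow_comm, zpow_natCast, pow_two, mul_eq_left] at h2
    rw [← hs, h2]
  -- The residue 2 has multiplicative order 4 modulo 5.
  have hb4dvd : 4 ∣ orderOf b := by
    have h1 := conj_pow_eq_of_conj_eq hb (orderOf b)
    rw [pow_orderOf_eq_one] at h1
    have h2 := hmod (i := 1) (by simpa using h1)
    rw [← Nat.div_add_mod (orderOf b) 4, pow_add, pow_mul, Nat.mul_mod, Nat.pow_mod] at h2
    have h3 : orderOf b % 4 < 4 := Nat.mod_lt _ four_pos
    apply Nat.dvd_of_mod_eq_zero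
    generalize orderOf b % 4 = r at *
    norm_num at h2
    interval_cases r <;> omega
  refine ⟨a, b, ⟨by rw [← ha, pow_orderOf_eq_one], hb, by rw [hb4, pow_zero], ?_, h⟩⟩
  have hcl : 20 ∣ Nat.card (closure {b, a}) := by
    apply Nat.Coprime.mul_dvd_of_dvd_of_dvd (by norm_num : Nat.Coprime 4 5)
    · have := orderOf_dvd_natCard (⟨b, subset_closure (by simp)⟩ : closure {b, a})
      rw [orderOf_mk] at this
      exact hb4dvd.trans this
    · have := orderOf_dvd_natCard (⟨a, subset_closure (by simp)⟩ : closure {b, a})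
      rwa [orderOf_mk, ha] at this
  apply eq_top_of_card_eq
  rw [h]
  have := card_subgroup_dvd_card (closure {b, a})
  rw [h] at this
  exact Nat.dvd_antisymm this hcl

end

theorem classification_of_card_center_eq_one {G : Type*} [Group G] [Finite G]
    (hG : ∃ x y : G, x * y ≠ y * x) (hz : Nat.card (center G) = 1)
    (hC : ∀ x : G, x ∉ center G → Nat.card (centralizer {x}) ≤ Nat.card (center G) + 5) :
    Nonempty (G ≃* Equiv.Perm (Fin 3)) ∨
       Nonempty (G ≃* DihedralGroup 5) ∨
       Nonempty (G ≃* alternatingGroup (Fin 4)) ∨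
       Nonempty (G ≃* (ZMod 5 ≃ᵃ[ZMod 5] ZMod 5)) ∨
       Nonempty (G ≃* alternatingGroup (Fin 5)) := by
  have hbot : center G = ⊥ := eq_bot_of_card_eq _ hz
  have hC' : ∀ x : G, x ≠ 1 → Nat.card (centralizer {x}) ≤ 6 := by
    intro x hx
    have := hC x (by rwa [hbot, mem_bot])
    omega
  have h60 := card_dvd_sixty hC' hz
  have h15 := card_ne_fifteen hC'
  have h30 := card_ne_thirty hC'
  have hpos : 0 < Nat.card G := Nat.card_pos
  have hcases : Nat.card G ∈ Nat.divisors 60 := Nat.mem_divisors.2 ⟨h60, by norm_num⟩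
  have hdiv : Nat.divisors 60 = {1, 2, 3, 4, 5, 6, 10, 12, 15, 20, 30, 60} := by decide +kernel
  have h4 := four_mul_card_center_le hG
  rw [hdiv] at hcases
  simp only [Finset.mem_insert, Finset.mem_singleton] at hcases
  have hcases' : Nat.card G = 4 ∨ Nat.card G = 5 ∨ Nat.card G = 6 ∨ Nat.card G = 10 ∨
      Nat.card G = 12 ∨ Nat.card G = 20 ∨ Nat.card G = 60 := by omega
  obtain ⟨x, y, hxy⟩ := id hG
  rcases hcases' with h | h | h | h | h | h | h
  · have : Fact (Nat.Prime 2) := ⟨Nat.prime_two⟩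
    have := IsPGroup.isMulCommutative_of_card_eq_prime_sq (p := 2) (G := G) h
    exact absurd (mul_comm' x y) hxy
  · have : Fact (Nat.Prime 5) := ⟨Nat.prime_five⟩
    have := isCyclic_of_prime_card (p := 5) h
    exact absurd (mul_comm' x y) hxy
  · left
    have : Fact (Nat.Prime 3) := ⟨Nat.prime_three⟩
    obtain ⟨a, ha⟩ := exists_prime_orderOf_dvd_card' (G := G) 3 (by rw [h]; norm_num)
    obtain ⟨b, r, s, hr, hs, hr1, hr2, hrs, hab⟩ := exists_isMetacyclicPair_two hG ha h
    have : r = 2 ∧ s = 0 := by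
      interval_cases r <;> interval_cases s <;> omega
    obtain ⟨rfl, rfl⟩ := this
    exact hab.nonempty_mulEquiv three_pos two_pos isMetacyclicPair_perm
  · right; left
    have : Fact (Nat.Prime 5) := ⟨Nat.prime_five⟩
    obtain ⟨a, ha⟩ := exists_prime_orderOf_dvd_card' (G := G) 5 (by rw [h]; norm_num)
    obtain ⟨b, r, s, hr, hs, hr1, hr2, hrs, hab⟩ := exists_isMetacyclicPair_two hG ha h
    have : r = 4 ∧ s = 0 := by
      interval_cases r <;> interval_cases s <;> omega
    obtain ⟨rfl, rfl⟩ := this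
    exact hab.nonempty_mulEquiv (by norm_num) two_pos (isMetacyclicPair_dihedralGroup 5)
  · right; right; left
    exact nonempty_mulEquiv_alternatingGroup_four hC' h
  · right; right; right; left
    obtain ⟨a, b, hab⟩ := exists_isMetacyclicPair_of_card_eq_twenty hC' h
    exact hab.nonempty_mulEquiv (by norm_num) four_pos isMetacyclicPair_affineFive
  · right; right; right; right
    exact nonempty_mulEquiv_alternatingGroup_five hC' h

/-! ### Centralizers of twice the order of the center -/

section

variable {G : Type*} [Group G]

theorem exists_mul_ne_of_notMem_center {x : G} (hx : x ∉ center G) : ∃ y, x * y ≠ y * x := by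
  rw [mem_center_iff] at hx
  push Not at hx
  obtain ⟨y, hy⟩ := hx
  exact ⟨y, hy.symm⟩

theorem two_mul_card_center_le_card_centralizer [Finite G] {x : G} (hx : x ∉ center G) :
    Nat.card (center G) ∣ Nat.card (centralizer {x}) ∧
      2 * Nat.card (center G) ≤ Nat.card (centralizer {x}) := by
  have hle := center_le_centralizer ({x} : Set G)
  obtain ⟨k, hk⟩ := card_dvd_of_le hle
  refine ⟨⟨k, hk⟩, ?_⟩
  rw [hk, mul_comm 2]
  apply Nat.mul_le_mul_left
  have hpos : 0 < Nat.card (centralizer {x}) := Nat.card_pos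
  have h0 : k ≠ 0 := by rintro rfl; omega
  have h1 : k ≠ 1 := by
    rintro rfl
    have := eq_of_le_of_card_ge hle (by omega)
    exact hx (this ▸ mem_centralizer_singleton_iff.2 rfl)
  omega

theorem four_mul_card_center_le_card [Finite G] {H : Subgroup G} (hle : center G ≤ H) {x y : G}
    (hx : x ∈ H) (hy : y ∈ H) (hxy : x * y ≠ y * x) : 4 * Nat.card (center G) ≤ Nat.card H := by
  have h1 := four_mul_card_center_le (G := H)
    ⟨⟨x, hx⟩, ⟨y, hy⟩, fun h => hxy (congrArg Subtype.val h)⟩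
  have h2 : Nat.card (center G) ≤ Nat.card (center H) := by
    refine Nat.card_le_card_of_injective (fun z => ⟨⟨z.1, hle z.2⟩, ?_⟩) ?_
    · rw [mem_center_iff]
      exact fun g => Subtype.ext (mem_center_iff.1 z.2 g)
    · intro a b hab
      exact Subtype.ext (congrArg (fun t : center H => ((t : H) : G)) hab)
  omega

/-- The center has index 2 in the centralizer, and `x` represents the other coset. -/
theorem mem_center_or_of_card_centralizer [Finite G] {x : G} (hx : x ∉ center G)
    (hcard : Nat.card (centralizer {x}) = 2 * Nat.card (center G)) {g : G} (hg : g * x = x * g) :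
    g ∈ center G ∨ x⁻¹ * g ∈ center G := by
  have hle := center_le_centralizer ({x} : Set G)
  have hidx : ((center G).subgroupOf (centralizer {x})).index = 2 := by
    have h1 := ((center G).subgroupOf (centralizer {x})).index_mul_card
    rw [Nat.card_congr (subgroupOfEquivOfLe hle).toEquiv, hcard] at h1
    exact Nat.eq_of_mul_eq_mul_right Nat.card_pos h1
  have h2 := mul_mem_iff_of_index_two hidx
    (a := (⟨x⁻¹, inv_mem (mem_centralizer_singleton_iff.2 rfl)⟩ : centralizer {x}))
    (b := ⟨g, mem_centralizer_singleton_iff.2 hg⟩)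
  simp only [mem_subgroupOf, coe_mul, inv_mem_iff] at h2
  tauto

/-- Apply the two-coset description of the centralizer to `x⁻¹`, which is not central. -/
theorem sq_mem_center_of_card_centralizer [Finite G] {x : G}
    (hcard : x ∉ center G → Nat.card (centralizer {x}) = 2 * Nat.card (center G)) :
    x ^ 2 ∈ center G := by
  by_cases hx : x ∈ center G
  · exact pow_mem hx 2
  · rcases mem_center_or_of_card_centralizer hx (hcard hx) (g := x⁻¹) (by group) with h | h
    · exact absurd (inv_mem_iff.1 h) hx
    · rw [← inv_mem_iff]
      convert h using 1
      group

/-- A commutator is a product of conjugates of squares and their inverses. -/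
theorem commutator_mem_center_of_sq {x y : G} (hx : x ^ 2 ∈ center G) (hy : y ^ 2 ∈ center G)
    (hxy : (x⁻¹ * y) ^ 2 ∈ center G) : x⁻¹ * (y * x * y⁻¹) ∈ center G := by
  have : x⁻¹ * (y * x * y⁻¹) = (x⁻¹ * y) ^ 2 * (y⁻¹ * x ^ 2 * y⁻¹⁻¹) * (y ^ 2)⁻¹ := by
    simp only [pow_two]; group
  rw [this]
  exact mul_mem (mul_mem hxy (instNormalCenter.conj_mem _ hx _)) (inv_mem hy)

theorem sq_eq_one_of_conj {x y c : G} (hx : x ^ 2 ∈ center G) (hc : c ∈ center G)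
    (h : y * x * y⁻¹ = x * c) : c ^ 2 = 1 := by
  have h1 : y * x ^ 2 * y⁻¹ = x ^ 2 := by rw [mem_center_iff.1 hx y, mul_inv_cancel_right]
  have h2 : Commute x c := mem_center_iff.1 hc x
  rw [← conj_pow, h, h2.mul_pow] at h1
  exact mul_eq_left.1 h1

end

/-! ### Order 16 with center of order 4 -/

section OrderSixteen

variable {G : Type*} [Group G]

/-- The commutator relation `y x = x y c`, for central `c` of order `2`. -/
structure IsCommutatorTriple (x y c : G) : Prop where
  mem_center : c ∈ center G
  sq_eq_one : c ^ 2 = 1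
  ne_one : c ≠ 1
  mul_eq : y * x = x * y * c

namespace IsCommutatorTriple

variable {x y c : G} (h : IsCommutatorTriple x y c)
include h

theorem mul_ne : x * y ≠ y * x := fun hxy => h.ne_one (mul_eq_left.1 (hxy.trans h.mul_eq).symm)

theorem conj_eq : y * x * y⁻¹ = x * c := by
  rw [h.mul_eq, mul_assoc x, mem_center_iff.1 h.mem_center, ← mul_assoc, mul_inv_cancel_right]

theorem symm : IsCommutatorTriple y x c where
  mem_center := h.mem_center
  sq_eq_one := h.sq_eq_one
  ne_one := h.ne_one
  mul_eq := by rw [h.mul_eq, mul_assoc _ c, ← pow_two, h.sq_eq_one, mul_one]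

theorem mul_right : IsCommutatorTriple x (x * y) c where
  mem_center := h.mem_center
  sq_eq_one := h.sq_eq_one
  ne_one := h.ne_one
  mul_eq := by rw [mul_assoc, h.mul_eq]; group

theorem mul_left_of_mem_center {z : G} (hz : z ∈ center G) : IsCommutatorTriple (x * z) y c where
  mem_center := h.mem_center
  sq_eq_one := h.sq_eq_one
  ne_one := h.ne_one
  mul_eq := by
    have h1 := mem_center_iff.1 hz
    rw [← mul_assoc, h.mul_eq, h1, h1 x, ← mul_assoc, ← mul_assoc]

theorem mul_sq : (x * y) ^ 2 = x ^ 2 * y ^ 2 * c := by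
  have hy : y * c = c * y := mem_center_iff.1 h.mem_center y
  calc (x * y) ^ 2 = x * (y * x) * y := by simp only [pow_two, mul_assoc]
    _ = x * x * y * (c * y) := by rw [h.mul_eq]; simp only [mul_assoc]
    _ = x ^ 2 * y ^ 2 * c := by rw [← hy]; simp only [pow_two, mul_assoc]

end IsCommutatorTriple

theorem exists_isCommutatorTriple {x y : G} (hx : x ^ 2 ∈ center G) (hy : y ^ 2 ∈ center G)
    (hxy : (x⁻¹ * y) ^ 2 ∈ center G) (hne : x * y ≠ y * x) : ∃ c, IsCommutatorTriple x y c := by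
  obtain ⟨c, hcdef⟩ : ∃ c, c = x⁻¹ * (y * x * y⁻¹) := ⟨_, rfl⟩
  have hc := commutator_mem_center_of_sq hx hy hxy
  rw [← hcdef] at hc
  have hconj : y * x * y⁻¹ = x * c := by rw [hcdef]; group
  refine ⟨c, hc, sq_eq_one_of_conj hx hc hconj, ?_, ?_⟩
  · intro hc1
    rw [hc1, mul_one, mul_inv_eq_iff_eq_mul] at hconj
    exact hne hconj.symm
  · rw [mul_inv_eq_iff_eq_mul] at hconj
    rw [hconj, mul_assoc, mul_assoc, mem_center_iff.1 hc y]

variable [Finite G]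

theorem IsCommutatorTriple.isCentralQuadruple {x y c d : G} {p q m i k l : ℕ}
    (h : IsCommutatorTriple x y (c ^ m))
    (hG : Nat.card G = 16) (hz : Nat.card (center G) = 4) (hc : c ∈ center G) (hd : d ∈ center G)
    (hcp : c ^ p = 1) (hdq : d ^ q = 1) (hgen : center G ≤ closure {d, c})
    (hx : x ^ 2 = c ^ i) (hy : y ^ 2 = c ^ k * d ^ l) :
    IsCentralQuadruple p q m i k l x y c d where
  pow_left := hcp
  pow_right := hdq
  mem_center_left := hc
  mem_center_right := hd
  sq_left := hx
  sq_right := hy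
  conj := h.conj_eq
  closure_eq_top := by
    have hle : center G ≤ closure {y, x, d, c} := hgen.trans (closure_mono (by
      intro t ht
      simp only [Set.mem_insert_iff, Set.mem_singleton_iff] at ht ⊢
      tauto))
    -- A subgroup containing the center and two noncommuting elements has order at least `4 * 4 =
    -- 16`.
    have h1 := four_mul_card_center_le_card hle (subset_closure (by simp))
      (subset_closure (by simp)) h.mul_ne
    have h2 := card_le_card_group (closure {y, x, d, c})
    apply eq_top_of_card_eq
    omega
  card := hG

/-- With cyclic center, multiplying an element by `t` multiplies its square by `t ^ 2`, so both
squares can be made 1 or `t`. If both are `t`, replacing `y` by `x * y` makes the second trivial,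
since its square is `t * t * t ^ 2`. -/
theorem isoToOneOfSix_of_orderOf_eq_four {x y t : G} (hG : Nat.card G = 16)
    (hz : Nat.card (center G) = 4) (hsq : ∀ g : G, g ^ 2 ∈ center G) (ht : t ∈ center G)
    (ht4 : orderOf t = 4) (h : IsCommutatorTriple x y (t ^ 2)) : IsoToOneOfSix G := by
  have htz : zpowers t = center G := by
    apply eq_of_le_of_card_ge ((zpowers_le).2 ht)
    rw [Nat.card_zpowers, ht4, hz]
  have ht4' : t ^ 4 = 1 := by rw [← ht4, pow_orderOf_eq_one]
  have hgen : center G ≤ closure {1, t} := by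
    rw [← htz, zpowers_le]
    exact subset_closure (by simp)
  have hpow : ∀ z ∈ center G, ∃ k < 4, t ^ k = z := by
    classical
    intro z hz
    rw [← htz, mem_zpowers_iff_mem_range_orderOf, ht4] at hz
    simpa using hz
  have hnormal : ∀ g : G, ∃ z ∈ center G, (g * z) ^ 2 = 1 ∨ (g * z) ^ 2 = t := by
    intro g
    obtain ⟨k, hk, hg⟩ := hpow _ (hsq g)
    have hcomm : Commute g t := mem_center_iff.1 ht g
    interval_cases k
    · exact ⟨1, one_mem _, Or.inl (by rw [mul_one, ← hg, pow_zero])⟩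
    · exact ⟨1, one_mem _, Or.inr (by rw [mul_one, ← hg, pow_one])⟩
    · exact ⟨t, ht, Or.inl (by rw [hcomm.mul_pow, ← hg, ← pow_add, ht4'])⟩
    · exact ⟨t, ht, Or.inr (by rw [hcomm.mul_pow, ← hg, ← pow_add, pow_succ, ht4', one_mul])⟩
  have hA : ∀ {x y : G}, IsCommutatorTriple x y (t ^ 2) → x ^ 2 = 1 → y ^ 2 = 1 →
      IsoToOneOfSix G := fun h hx hy => by
    iterate 5 right
    exact (h.isCentralQuadruple (p := 4) (q := 1) (i := 0) (k := 0) (l := 0) hG hz ht (one_mem _)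
      ht4' (one_pow _) hgen (by simpa using hx) (by simpa using hy)).nonempty_mulEquiv rfl
        isCentralQuadruple_C4C2sdC2₂
  have hB : ∀ {x y : G}, IsCommutatorTriple x y (t ^ 2) → x ^ 2 = t → y ^ 2 = 1 →
      IsoToOneOfSix G := fun h hx hy => by
    right; right; left
    exact (h.isCentralQuadruple (p := 4) (q := 1) (i := 1) (k := 0) (l := 0) hG hz ht (one_mem _)
      ht4' (one_pow _) hgen (by simpa using hx) (by simpa using hy)).nonempty_mulEquiv rfl
        isCentralQuadruple_C8sdC2
  obtain ⟨u, hu, hxu⟩ := hnormal x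
  obtain ⟨v, hv, hyv⟩ := hnormal y
  have h' := ((h.mul_left_of_mem_center hu).symm.mul_left_of_mem_center hv).symm
  rcases hxu with hx | hx <;> rcases hyv with hy | hy
  · exact hA h' hx hy
  · exact hB h'.symm hy hx
  · exact hB h' hx hy
  · refine hB h'.mul_right hx ?_
    rw [h'.mul_sq, hx, hy, ← pow_two, ← pow_add, ht4']

/-- Central factors no longer change squares, so what matters is their position relative to `zpowers
c`, of index 2 in the center. One generator can always be given a square in it. If the other square
lies outside, it serves as the second central generator; otherwise any outside `d` will do, and a
direct factor of order 2 appears. -/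
theorem isoToOneOfSix_of_elementary {x y c : G} (hG : Nat.card G = 16)
    (hz : Nat.card (center G) = 4) (hsq : ∀ g : G, g ^ 2 ∈ center G)
    (hz2 : ∀ z ∈ center G, z ^ 2 = 1) (h : IsCommutatorTriple x y c) : IsoToOneOfSix G := by
  have hc := h.mem_center
  have hord : orderOf c = 2 := orderOf_eq_prime (hp := ⟨Nat.prime_two⟩) h.sq_eq_one h.ne_one
  have hzc : Nat.card (zpowers c) = 2 := by rw [Nat.card_zpowers, hord]
  have hzle : zpowers c ≤ center G := (zpowers_le).2 hc
  have hpow : ∀ z ∈ zpowers c, z = 1 ∨ z = c := by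
    classical
    intro z hz
    rw [mem_zpowers_iff_mem_range_orderOf, hord] at hz
    simp only [Finset.mem_image, Finset.mem_range] at hz
    obtain ⟨k, hk, rfl⟩ := hz
    interval_cases k <;> simp
  have hgen : ∀ d ∈ center G, d ∉ zpowers c → center G ≤ closure {d, c} := by
    intro d hd hdc
    have h1 : zpowers c ≤ closure {d, c} := (zpowers_le).2 (subset_closure (by simp))
    have h2 : closure {d, c} ≤ center G := by
      rw [closure_le]
      rintro _ (rfl | rfl)
      exacts [hd, hc]
    have h3 := card_dvd_of_le h1
    have h4 := card_le_of_le h2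
    have h5 : Nat.card (closure {d, c}) ≠ 2 := by
      intro h5
      have := eq_of_le_of_card_ge h1 (by omega)
      exact hdc (this ▸ subset_closure (by simp))
    have h6 := card_dvd_of_le h2
    rw [hz] at h6
    have h7 : Nat.card (closure {d, c}) = 4 := by
      have hpos : 0 < Nat.card (closure {d, c}) := Nat.card_pos
      rw [hzc] at h3
      omega
    exact (eq_of_le_of_card_ge h2 (by omega)).ge
  have hprod : ∀ a ∈ center G, ∀ b ∈ center G, a ∉ zpowers c → b ∉ zpowers c →
      a * b ∈ zpowers c := by
    intro a ha b hb hac hbc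
    have hidx : ((zpowers c).subgroupOf (center G)).index = 2 := by
      have h1 := ((zpowers c).subgroupOf (center G)).index_mul_card
      rw [Nat.card_congr (subgroupOfEquivOfLe hzle).toEquiv, hzc, hz] at h1
      omega
    have h2 := mul_mem_iff_of_index_two hidx (a := ⟨a, ha⟩) (b := ⟨b, hb⟩)
    simp only [mem_subgroupOf, coe_mul] at h2
    tauto
  obtain ⟨d, hd, hdc⟩ : ∃ d ∈ center G, d ∉ zpowers c := by
    by_contra! hle
    have := card_le_of_le (show center G ≤ zpowers c from hle)
    omega
  obtain ⟨x, y, h, hx⟩ : ∃ x y : G, IsCommutatorTriple x y c ∧ x ^ 2 ∈ zpowers c := by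
    by_cases hx : x ^ 2 ∈ zpowers c
    · exact ⟨x, y, h, hx⟩
    by_cases hy : y ^ 2 ∈ zpowers c
    · exact ⟨y, x, h.symm, hy⟩
    -- Two squares outside `zpowers c` have their product inside, and `(x * y) ^ 2` is that product
    -- times `c`.
    refine ⟨x * y, x, h.mul_right.symm, ?_⟩
    rw [h.mul_sq]
    exact mul_mem (hprod _ (hsq x) _ (hsq y) hx hy) (mem_zpowers c)
  have key : ∀ {i k l : ℕ} {x y d : G}, IsCommutatorTriple x y c → d ∈ center G →
      d ∉ zpowers c → x ^ 2 = c ^ i → y ^ 2 = c ^ k * d ^ l →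
      IsCentralQuadruple 2 2 1 i k l x y c d := by
    intro i k l x y d h hd hdc hx hy
    exact IsCommutatorTriple.isCentralQuadruple (by rwa [pow_one]) hG hz hc hd h.sq_eq_one
      (hz2 d hd) (hgen d hd hdc) hx hy
  have hA : ∀ {x y : G}, IsCommutatorTriple x y c → x ^ 2 = 1 → y ^ 2 = 1 → IsoToOneOfSix G :=
    fun h hx hy => by
      right; right; right; left
      exact (key (i := 0) (k := 0) (l := 0) h hd hdc (by simpa using hx)
        (by simpa using hy)).nonempty_mulEquiv rfl isCentralQuadruple_dihedralGroup_prod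
  by_cases hy : y ^ 2 ∈ zpowers c
  · rcases hpow _ hx with hx | hx <;> rcases hpow _ hy with hy | hy
    · exact hA h hx hy
    · refine hA h.mul_right hx ?_
      rw [h.mul_sq, hx, hy, one_mul, ← pow_two, h.sq_eq_one]
    · refine hA h.symm.mul_right hy ?_
      rw [h.symm.mul_sq, hx, hy, one_mul, ← pow_two, h.sq_eq_one]
    · iterate 4 right
      left
      exact (key (i := 1) (k := 1) (l := 0) h hd hdc (by simpa using hx)
        (by simpa using hy)).nonempty_mulEquiv rfl isCentralQuadruple_quaternionGroup_prod
  · rcases hpow _ hx with hx | hx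
    · left
      exact (key (i := 0) (k := 0) (l := 1) h (hsq y) hy (by simpa using hx)
        (by simp)).nonempty_mulEquiv rfl isCentralQuadruple_C4C2sdC2₁
    · right; left
      exact (key (i := 1) (k := 0) (l := 1) h (hsq y) hy (by simpa using hx)
        (by simp)).nonempty_mulEquiv rfl isCentralQuadruple_C4sdC4

theorem isoToOneOfSix_of_card (hG : Nat.card G = 16) (hz : Nat.card (center G) = 4) :
    IsoToOneOfSix G := by
  have hC : ∀ x ∉ center G, Nat.card (centralizer {x}) = 2 * Nat.card (center G) := by
    intro x hx
    obtain ⟨h1, h2⟩ := two_mul_card_center_le_card_centralizer hx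
    obtain ⟨y, hxy⟩ := exists_mul_ne_of_notMem_center hx
    have h3 := card_subgroup_dvd_card (centralizer {x})
    have h4 : Nat.card (centralizer {x}) ≠ 16 := by
      intro h4
      have := eq_top_of_card_eq _ (h4.trans hG.symm)
      exact hxy (mem_centralizer_singleton_iff.1 (this ▸ mem_top y)).symm
    rw [hG] at h3
    rw [hz] at h1 h2 ⊢
    have h5 := Nat.le_of_dvd (by norm_num) h3
    generalize Nat.card (centralizer {x}) = n at *
    interval_cases n <;> omega
  have hsq : ∀ g : G, g ^ 2 ∈ center G := fun g => sq_mem_center_of_card_centralizer (hC g)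
  obtain ⟨x, hx⟩ : ∃ x, x ∉ center G := by
    by_contra! hall
    have : center G = ⊤ := (eq_top_iff' _).2 hall
    rw [this, card_top] at hz
    omega
  obtain ⟨y, hxy⟩ := exists_mul_ne_of_notMem_center hx
  obtain ⟨c, h⟩ := exists_isCommutatorTriple (hsq x) (hsq y) (hsq _) hxy
  by_cases hcyc : ∃ t ∈ center G, orderOf t = 4
  · obtain ⟨t, ht, ht4⟩ := hcyc
    have htz : zpowers t = center G := by
      apply eq_of_le_of_card_ge ((zpowers_le).2 ht)
      rw [Nat.card_zpowers, ht4, hz]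
    have hct : c = t ^ 2 := by
      classical
      have h1 := h.mem_center
      rw [← htz, mem_zpowers_iff_mem_range_orderOf, ht4] at h1
      simp only [Finset.mem_image, Finset.mem_range] at h1
      obtain ⟨k, hk, hkc⟩ := h1
      have h2 := h.sq_eq_one
      rw [← hkc, ← pow_mul] at h2
      have h3 := orderOf_dvd_of_pow_eq_one h2
      rw [ht4] at h3
      have h4 : k ≠ 0 := by
        rintro rfl
        exact h.ne_one (by rw [← hkc, pow_zero])
      have : k = 2 := by omega
      rw [← hkc, this]
    exact isoToOneOfSix_of_orderOf_eq_four hG hz hsq ht ht4 (hct ▸ h)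
  · push Not at hcyc
    refine isoToOneOfSix_of_elementary hG hz hsq (fun z hzc => ?_) h
    have h1 := orderOf_dvd_natCard (⟨z, hzc⟩ : center G)
    rw [orderOf_mk, hz] at h1
    have h2 := hcyc z hzc
    have h3 := Nat.le_of_dvd four_pos h1
    apply orderOf_dvd_iff_pow_eq_one.1
    generalize orderOf z = n at *
    interval_cases n <;> omega

end OrderSixteen

/-! ### Excluding centers of order 3 and 5, and order 32 -/

section

variable {G : Type*} [Group G] [Finite G]

/-- The inequalities allow only one factor `p` in `|G|`, and beyond it at most one factor 2. Then
`|G| ≤ 2 * p`, whereas a nonabelian group has order at least `4 * p`. -/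
theorem card_center_not_odd_prime (hG : ∃ x y : G, x * y ≠ y * x) {p : ℕ} (hp : p.Prime)
    (h2 : p + 5 < p ^ 2) (h3 : p + 5 < 3 * p) (hz : Nat.card (center G) = p)
    (hC : ∀ x : G, x ∉ center G → Nat.card (centralizer {x}) ≤ p + 5) : False := by
  have hp0 := hp.pos
  have hdvd : Nat.card G ∣ 2 * p := by
    rw [Nat.dvd_iff_prime_pow_dvd_dvd]
    intro q k hq hdvd
    rcases eq_or_ne k 0 with rfl | hk
    · simp
    by_cases hqp : q = p
    · subst hqp
      have hk1 : k = 1 := by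
        by_contra hk1
        obtain ⟨x, hx, hxd⟩ := exists_sq_dvd_card_centralizer hp
          ((pow_dvd_pow q (by omega : 2 ≤ k)).trans hdvd) (by omega)
        have := Nat.le_of_dvd Nat.card_pos hxd
        have := hC x hx
        omega
      rw [hk1, pow_one]
      exact dvd_mul_left _ _
    · obtain ⟨x, hx, hxd⟩ := exists_pow_mul_card_center_dvd_card_centralizer hq hk hdvd
        (by rw [hz]; exact fun h => hqp ((Nat.prime_dvd_prime_iff_eq hq hp).1 h))
      rw [hz] at hxd
      have h4 := (Nat.le_of_dvd Nat.card_pos hxd).trans (hC x hx)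
      have h5 : q ^ k < 3 := by
        by_contra! h
        have := Nat.mul_le_mul_right p h
        omega
      have h6 : 1 < q ^ k := Nat.one_lt_pow hk hq.one_lt
      have h7 : q ^ k = 2 := by omega
      rw [h7]
      exact dvd_mul_right _ _
  have := Nat.le_of_dvd (by omega) hdvd
  have := four_mul_card_center_le hG
  omega

/-- Commutators are central and bilinear here. For `x`, `y`, `w` independent modulo the center, the
three commutators are distinct and nontrivial, so with 1 they fill the center and the product of two
is the third. Then `x * w` and `y * w` commute, although they lie in different nontrivial cosets of
the center. -/
theorem card_ne_thirtyTwo_of_card_center_eq_four (hz : Nat.card (center G) = 4)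
    (hC : ∀ x : G, x ∉ center G → Nat.card (centralizer {x}) = 8) : Nat.card G ≠ 32 := by
  intro hG
  have hC' : ∀ x : G, x ∉ center G → Nat.card (centralizer {x}) = 2 * Nat.card (center G) := by
    intro x hx
    rw [hC x hx, hz]
  have hsq : ∀ g : G, g ^ 2 ∈ center G := fun g => sq_mem_center_of_card_centralizer (hC' g)
  have hcomm : ∀ {x g : G}, x ∉ center G → g * x = x * g → g ∈ center G ∨ x⁻¹ * g ∈ center G :=
    fun hx hg => mem_center_or_of_card_centralizer hx (hC' _ hx) hg
  have hcen : ∀ {z : G}, z ∈ center G → ∀ g, g * z = z * g := fun hz => mem_center_iff.1 hz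
  obtain ⟨x, hx⟩ : ∃ x, x ∉ center G := by
    by_contra! hall
    have : center G = ⊤ := (eq_top_iff' _).2 hall
    rw [this, card_top] at hz
    omega
  obtain ⟨y, hxy⟩ := exists_mul_ne_of_notMem_center hx
  have hy : y ∉ center G := fun hy => hxy (hcen hy x)
  set A := centralizer {x} with hA
  have hZA : center G ≤ A := center_le_centralizer _
  have hxA : x ∈ A := mem_centralizer_singleton_iff.2 rfl
  have hyA : y ∉ A := fun h => hxy (mem_centralizer_singleton_iff.1 h).symm
  have hA8 : Nat.card A = 8 := hC x hx
  -- The two cosets `A` and `y A` cover only 16 of the 32 elements.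
  obtain ⟨w, hw, hyw⟩ : ∃ w, w ∉ A ∧ y⁻¹ * w ∉ A := by
    by_contra! hall
    have hsub : (Set.univ : Set G) ⊆ (A : Set G) ∪ (fun g => y * g) '' (A : Set G) := by
      intro w _
      by_cases hw : w ∈ A
      · exact Or.inl hw
      · exact Or.inr ⟨y⁻¹ * w, hall w hw, by group⟩
    have h1 := Set.ncard_le_ncard hsub
    have h2 := Set.ncard_union_le (A : Set G) ((fun g => y * g) '' (A : Set G))
    rw [Set.ncard_image_of_injective _ (mul_right_injective y), ← Nat.card_coe_set_eq (A : Set G)]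
      at h2
    change _ ≤ Nat.card A + Nat.card A at h2
    rw [Set.ncard_univ, hG] at h1
    omega
  have hwZ : w ∉ center G := fun h => hw (hZA h)
  have hxw : x * w ≠ w * x := fun h => hw (mem_centralizer_singleton_iff.2 h.symm)
  have hywc : y * w ≠ w * y := by
    intro h
    rcases hcomm hy h.symm with h | h
    · exact hwZ h
    · exact hyw (hZA h)
  have htriple : ∀ {u v : G}, u * v ≠ v * u → ∃ c, IsCommutatorTriple u v c :=
    fun h => exists_isCommutatorTriple (hsq _) (hsq _) (hsq _) h
  obtain ⟨a, ha⟩ := htriple hxy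
  obtain ⟨b, hb⟩ := htriple hxw
  obtain ⟨c, hc⟩ := htriple hywc
  have hconjA : ∀ g, g⁻¹ * x * g ∈ A := by
    intro g
    have h := commutator_mem_center_of_sq (hsq x) (hsq g⁻¹) (hsq _)
    rw [inv_inv] at h
    have := mul_mem hxA (hZA h)
    rwa [mul_inv_cancel_left] at this
  -- Equality would make `y⁻¹ * w` commute with `x`; the next two cases similarly pair `w` with `x⁻¹
  -- * y`, and `y` with `x⁻¹ * w`.
  have hab : a ≠ b := by
    rintro rfl
    apply hyw
    rw [mem_centralizer_singleton_iff]
    have h1 := ha.conj_eq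
    have h2 := hb.conj_eq
    have h3 : y * x * y⁻¹ = w * x * w⁻¹ := h1.trans h2.symm
    calc y⁻¹ * w * x = y⁻¹ * (w * x * w⁻¹) * w := by group
      _ = x * (y⁻¹ * w) := by rw [← h3]; group
  have hbc : b ≠ c := by
    rintro rfl
    have h1 : x⁻¹ * y ∉ center G := by
      intro h
      apply hyA
      have := mul_mem hxA (hZA h)
      rwa [mul_inv_cancel_left] at this
    have h2 : w * (x⁻¹ * y) = x⁻¹ * y * w := by
      rw [← mul_inv_eq_iff_eq_mul]
      have hbx := hcen hb.mem_center
      calc w * (x⁻¹ * y) * w⁻¹ = (w * x * w⁻¹)⁻¹ * (w * y * w⁻¹) := by group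
        _ = b⁻¹ * (x⁻¹ * y * b) := by rw [hb.conj_eq, hc.conj_eq]; group
        _ = x⁻¹ * y := by rw [hbx, inv_mul_cancel_left]
    rcases hcomm h1 h2 with h | h
    · exact hwZ h
    · apply hyw
      have h3 := mul_mem (hZA h) (inv_mem (hconjA w))
      convert h3 using 1
      group
  have hac : a ≠ c := by
    rintro rfl
    have h1 : x⁻¹ * w * y = y * (x⁻¹ * w) := by
      rw [eq_comm, ← mul_inv_eq_iff_eq_mul]
      have hax := hcen ha.mem_center
      calc y * (x⁻¹ * w) * y⁻¹ = (y * x * y⁻¹)⁻¹ * (y * w * y⁻¹) := by group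
        _ = a⁻¹ * (x⁻¹ * w * a) := by rw [ha.conj_eq, hc.symm.conj_eq]; group
        _ = x⁻¹ * w := by rw [hax, inv_mul_cancel_left]
    rcases hcomm hy h1 with h | h
    · apply hw
      have := mul_mem hxA (hZA h)
      rwa [mul_inv_cancel_left] at this
    · apply hyw
      have h3 := mul_mem (hZA h) (hconjA w)
      convert h3 using 1
      group
  -- Otherwise 1, `a`, `b`, `c`, `a * b` would be five distinct elements of a center of order 4.
  have habc : a * b = c := by
    by_contra habc
    classical
    have hab1 : a * b ≠ 1 := by
      intro h
      apply hab
      have := ha.sq_eq_one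
      rw [pow_two, ← h] at this
      exact mul_left_cancel this
    have hsub : ((({1, a, b, c, a * b} : Finset G) : Set G)) ⊆ (center G : Set G) := by
      intro t ht
      simp only [Finset.coe_insert, Finset.coe_singleton, Set.mem_insert_iff,
        Set.mem_singleton_iff] at ht
      rcases ht with rfl | rfl | rfl | rfl | rfl
      exacts [one_mem _, ha.mem_center, hb.mem_center, hc.mem_center,
        mul_mem ha.mem_center hb.mem_center]
    have h1 := Set.ncard_le_ncard hsub
    rw [Set.ncard_coe_finset, ← Nat.card_coe_set_eq (center G : Set G)] at h1
    change _ ≤ Nat.card (center G) at h1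
    have h2 : ({1, a, b, c, a * b} : Finset G).card = 5 := by
      have hab2 : a ≠ a * b := fun h => hb.ne_one (mul_eq_left.1 h.symm)
      have hab3 : b ≠ a * b := fun h => ha.ne_one (mul_eq_right.1 h.symm)
      rw [Finset.card_insert_of_notMem, Finset.card_insert_of_notMem,
        Finset.card_insert_of_notMem, Finset.card_insert_of_notMem, Finset.card_singleton]
      · simpa using Ne.symm habc
      · simpa only [Finset.mem_insert, Finset.mem_singleton, not_or] using ⟨hbc, hab3⟩
      · simpa only [Finset.mem_insert, Finset.mem_singleton, not_or] using ⟨hab, hac, hab2⟩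
      · simpa only [Finset.mem_insert, Finset.mem_singleton, not_or] using
          ⟨ha.ne_one.symm, hb.ne_one.symm, hc.ne_one.symm, hab1.symm⟩
    omega
  have hfin : y * w * (x * w) = x * w * (y * w) := by
    have hbw := hcen hb.mem_center
    have hcw := hcen hc.mem_center
    have haw := hcen ha.mem_center
    calc y * w * (x * w) = y * (w * x) * w := by group
      _ = y * x * w * (b * w) := by rw [hb.mul_eq]; group
      _ = x * y * (a * w) * (b * w) := by rw [ha.mul_eq]; group
      _ = x * y * w * w * (a * b) := by
        rw [← hbw w, mul_assoc (x * y), mul_assoc a, ← haw, mul_assoc w, mul_assoc w,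
          ← hbw a]
        simp only [mul_assoc]
      _ = x * (y * w * c) * w := by rw [habc, mul_assoc _ w c, hcw]; group
      _ = x * w * (y * w) := by rw [← hc.mul_eq]; group
  have hxwZ : x * w ∉ center G := by
    intro h
    apply hw
    have := mul_mem (inv_mem hxA) (hZA h)
    rwa [inv_mul_cancel_left] at this
  rcases hcomm hxwZ hfin with h | h
  · have h1 := hcen h y
    apply hywc
    rw [mul_assoc] at h1
    exact mul_left_cancel h1
  · apply hyA
    have h1 := instNormalCenter.conj_mem _ h w
    have h2 := mul_mem hxA (hZA h1)
    convert h2 using 1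
    group

end

/-! ### Orders of groups with center of order 4 or 2 -/

section

variable {G : Type*} [Group G] [Finite G]

theorem card_eq_sixteen_of_card_center_eq_four (hG : ∃ x y : G, x * y ≠ y * x)
    (hz : Nat.card (center G) = 4)
    (hC : ∀ x : G, x ∉ center G → Nat.card (centralizer {x}) ≤ 9) : Nat.card G = 16 := by
  have : Fact (Nat.Prime 2) := ⟨Nat.prime_two⟩
  have hC8 : ∀ x : G, x ∉ center G → Nat.card (centralizer {x}) = 8 := by
    intro x hx
    have h1 := two_mul_card_center_le_card_centralizer hx
    have h2 := hC x hx
    rw [hz] at h1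
    omega
  have hprime : ∀ {p : ℕ}, p.Prime → p ∣ Nat.card G → p = 2 := by
    intro p hp hdvd
    by_contra hne
    obtain ⟨x, hx, hxd⟩ := exists_pow_mul_card_center_dvd_card_centralizer hp one_ne_zero
      (by rwa [pow_one]) (by
        rw [hz]
        exact fun h => hne ((Nat.prime_dvd_prime_iff_eq hp Nat.prime_two).1
          (hp.dvd_of_dvd_pow (show p ∣ 2 ^ 2 from h))))
    rw [pow_one, hz, hC8 x hx] at hxd
    have := hp.two_le
    have := Nat.le_of_dvd (by norm_num) hxd
    omega
  have hpow := Nat.eq_prime_pow_of_unique_prime_dvd (Nat.card_pos (α := G)).ne' hprime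
  have hpg : IsPGroup 2 G := IsPGroup.of_card hpow
  have hne : center G ≠ ⊤ := by
    intro h
    obtain ⟨x, y, hxy⟩ := hG
    exact hxy (mem_center_iff.1 (h ▸ mem_top y : y ∈ center G) x)
  -- A conjugacy class of size at most 4 and a centralizer of order 8 give `|G| ≤ 32`.
  obtain ⟨x, hx, hle⟩ := hpg.exists_card_le_mul_card_center hne
  rw [hC8 x hx, hz] at hle
  have h16 := four_mul_card_center_le hG
  have h32 := card_ne_thirtyTwo_of_card_center_eq_four hz hC8
  generalize (Nat.card G).primeFactorsList.length = k at hpow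
  rw [hpow] at hle h16 h32 ⊢
  have hk : k < 6 := (Nat.pow_lt_pow_iff_right (a := 2) (by norm_num)).1
    (lt_of_le_of_lt hle (by norm_num))
  interval_cases k <;> omega

theorem card_dvd_twentyFour (hz : Nat.card (center G) = 2)
    (hC : ∀ x : G, x ∉ center G → Nat.card (centralizer {x}) ≤ 7) : Nat.card G ∣ 24 := by
  rw [Nat.dvd_iff_prime_pow_dvd_dvd]
  intro p k hp hdvd
  rcases eq_or_ne k 0 with rfl | hk
  · simp
  by_cases hp2 : p = 2
  · subst hp2
    have hk3 : k ≤ 3 := by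
      by_contra! hk3
      have : Fact (Nat.Prime 2) := ⟨Nat.prime_two⟩
      obtain ⟨Q, hQ⟩ := Sylow.exists_subgroup_card_pow_prime 2
        ((pow_dvd_pow 2 (by omega : 4 ≤ k)).trans hdvd)
      have hZ : ∀ q : Q, (q : G) ∉ center G → Nat.card (centralizer {q}) ≤ 7 := by
        intro q hq
        refine le_trans ?_ (hC q hq)
        refine Nat.card_le_card_of_injective (fun g => ⟨g.1.1, ?_⟩) ?_
        · exact mem_centralizer_singleton_iff.2
            (congrArg Subtype.val (mem_centralizer_singleton_iff.1 g.2))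
        · intro g k hgk
          exact Subtype.ext (Subtype.ext (Subtype.mk.inj hgk))
      -- A central element of `Q` has a centralizer of order at least 16, too large for an element
      -- noncentral in `G`. So `Q` has a center of order at most 2, a class of size at most 2, and
      -- order at most `7 * 2`.
      have hcQ : ∀ q ∈ center Q, (q : G) ∈ center G := by
        intro q hq
        by_contra hqG
        have h1 := hZ q hqG
        have h2 : centralizer {q} = ⊤ := by
          rw [eq_top_iff']
          exact fun g => mem_centralizer_singleton_iff.2 (mem_center_iff.1 hq g)
        rw [h2, card_top, hQ] at h1
        omega
      have hcard : Nat.card (center Q) ≤ 2 := by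
        rw [← hz]
        refine Nat.card_le_card_of_injective (fun q => ⟨q.1.1, hcQ q.1 q.2⟩) ?_
        intro g k hgk
        exact Subtype.ext (Subtype.ext (Subtype.mk.inj hgk))
      have hne : center Q ≠ ⊤ := by
        intro h
        rw [h, card_top, hQ] at hcard
        omega
      obtain ⟨q, hq, hle⟩ := (IsPGroup.of_card hQ).exists_card_le_mul_card_center hne
      have hqG : (q : G) ∉ center G := fun h =>
        hq (mem_center_iff.2 fun g => Subtype.ext (mem_center_iff.1 h g))
      have h1 := Nat.mul_le_mul (hZ q hqG) hcard
      rw [hQ] at hle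
      omega
    exact (pow_dvd_pow 2 hk3).trans (by norm_num)
  · obtain ⟨x, hx, hxd⟩ := exists_pow_mul_card_center_dvd_card_centralizer hp hk hdvd
      (by rw [hz]; exact fun h => hp2 ((Nat.prime_dvd_prime_iff_eq hp Nat.prime_two).1 h))
    rw [hz] at hxd
    have h1 := (Nat.le_of_dvd Nat.card_pos hxd).trans (hC x hx)
    have h2 : 2 < p ^ k := by
      have := hp.two_le
      exact lt_of_lt_of_le (by omega : 2 < p) (Nat.le_self_pow hk p)
    have h3 : p ^ k = 3 := by omega
    rw [h3]
    norm_num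

end

/-! ### Center of order 2 -/

section

variable {G : Type*} [Group G] [Finite G]

/-- The Sylow 3-subgroup is centralized by its normalizer, so Burnside's transfer theorem provides a
normal complement. -/
theorem exists_normal_card_eq_eight (hG : Nat.card G = 24) (hz : Nat.card (center G) = 2)
    (hC : ∀ x : G, x ∉ center G → Nat.card (centralizer {x}) ≤ 7) :
    ∃ (w : G) (K : Subgroup G), orderOf w = 3 ∧ K.Normal ∧ Nat.card K = 8 := by
  have : Fact (Nat.Prime 3) := ⟨Nat.prime_three⟩
  obtain ⟨P⟩ : Nonempty (Sylow 3 G) := inferInstance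
  have hP : Nat.card P = 3 := by
    have hf : Nat.factorization 24 3 = 1 := by
      rw [Nat.factorization_def _ Nat.prime_three]
      decide +kernel
    rw [P.card_eq_multiplicity, hG, hf, pow_one]
  obtain ⟨⟨w, hwP⟩, hw⟩ := exists_prime_orderOf_dvd_card' (G := P) 3 (by rw [hP])
  rw [orderOf_mk] at hw
  have hPw : zpowers w = P := by
    apply eq_of_le_of_card_ge ((zpowers_le).2 hwP)
    rw [Nat.card_zpowers, hw, hP]
  have hwZ : w ∉ center G := by
    intro h
    have := orderOf_dvd_natCard (⟨w, h⟩ : center G)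
    rw [orderOf_mk, hw, hz] at this
    omega
  have hw1 : w ≠ 1 := fun h => hwZ (h ▸ one_mem _)
  have hCw : Nat.card (centralizer {w}) = 6 := by
    have h1 := two_mul_card_center_le_card_centralizer hwZ
    have h2 := orderOf_dvd_card_centralizer (x := w) (g := w) rfl
    have h3 := hC w hwZ
    rw [hz] at h1
    rw [hw] at h2
    omega
  have hcent : centralizer {w} = centralizer (P : Set G) := by
    have : centralizer (zpowers w : Set G) = centralizer {w} := by
      rw [zpowers_eq_closure, centralizer_closure]
    rw [← this, hPw]
    rfl
  have hle : centralizer {w} ≤ normalizer (P : Set G) := by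
    rw [hcent]
    exact centralizer_le_normalizer _
  have hidx := (normalizer (P : Set G)).index_mul_card
  rw [hG] at hidx
  have hmod := card_sylow_modEq_one 3 G
  rw [P.card_eq_index_normalizer] at hmod
  have h6 : 6 ∣ Nat.card (normalizer (P : Set G)) := hCw ▸ card_dvd_of_le hle
  obtain ⟨m, hm⟩ := h6
  have hi : (normalizer (P : Set G)).index = 4 := by
    -- A normal `P` would leave `w` at most 2 conjugates, so `|G| ≤ 12`.
    have hi1 : (normalizer (P : Set G)).index ≠ 1 := by
      intro h1
      have hn : (P : Subgroup G).Normal := normalizer_eq_top_iff.1 (index_eq_one.1 h1)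
      have := card_le_mul_card_sub_one_of_normal hn hwP hw1
      rw [hCw, hG, hP] at this
      omega
    rw [hm] at hidx
    have h4 : (normalizer (P : Set G)).index ∣ 4 := ⟨m, by nlinarith⟩
    have h5 := Nat.le_of_dvd four_pos h4
    rw [Nat.ModEq] at hmod
    generalize (normalizer (P : Set G)).index = n at *
    interval_cases n <;> omega
  rw [hi] at hidx
  have hN : centralizer {w} = normalizer (P : Set G) := eq_of_le_of_card_ge hle (by omega)
  have hNC : normalizer (P : Set G) ≤ centralizer (P : Set G) := by rw [← hN, hcent]
  have hcompl := (MonoidHom.ker_transferSylow_isComplement' P hNC).card_mul_card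
  rw [hP] at hcompl
  exact ⟨w, (MonoidHom.transferSylow P hNC).ker, hw, inferInstance, by omega⟩

theorem exists_isBinaryTetrahedralTriple (hG : Nat.card G = 24) (hz : Nat.card (center G) = 2)
    (hC : ∀ x : G, x ∉ center G → Nat.card (centralizer {x}) ≤ 7) :
    ∃ x y w : G, IsBinaryTetrahedralTriple x y w := by
  obtain ⟨w, K, hw, hKn, hK⟩ := exists_normal_card_eq_eight hG hz hC
  have hw3 : w ^ 3 = 1 := by rw [← hw, pow_orderOf_eq_one]
  have hz2 : ∀ u ∈ center G, u ^ 2 = 1 := by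
    intro u hu
    have := pow_card_eq_one' (x := (⟨u, hu⟩ : center G))
    rw [hz] at this
    exact congrArg Subtype.val this
  have hcen : ∀ {u : G}, u ∈ center G → ∀ g, g * u = u * g := fun hu => mem_center_iff.1 hu
  have hZK : center G ≤ K := by
    intro u hu
    have hidx : K.index = 3 := by
      have := K.index_mul_card
      rw [hK, hG] at this
      omega
    have := K.pow_index_mem u
    rwa [hidx, pow_succ, hz2 u hu, one_mul] at this
  have hC4 : ∀ x ∈ K, x ∉ center G → Nat.card (centralizer {x}) = 2 * Nat.card (center G) := by
    intro x hxK hx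
    have hle : center G ≤ K ⊓ centralizer {x} := le_inf hZK (center_le_centralizer _)
    have h1 : Nat.card (K ⊓ centralizer {x} : Subgroup G) ∣ 8 := hK ▸ card_dvd_of_le inf_le_left
    have h2 := card_dvd_of_le (inf_le_right : K ⊓ centralizer {x} ≤ centralizer {x})
    have h3 := card_dvd_of_le hle
    have h4 : Nat.card (K ⊓ centralizer {x} : Subgroup G) ≠ 2 := by
      intro h4
      have := eq_of_le_of_card_ge hle (by omega)
      exact hx (this ▸ ⟨hxK, mem_centralizer_singleton_iff.2 rfl⟩)
    have h5 := hC x hx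
    have h6 := Nat.le_of_dvd Nat.card_pos h2
    have h7 := two_mul_card_center_le_card_centralizer hx
    rw [hz] at h3 h7 ⊢
    generalize Nat.card (K ⊓ centralizer {x} : Subgroup G) = n at *
    generalize Nat.card (centralizer {x}) = m at *
    have hn : n ≤ 7 := h6.trans h5
    interval_cases n <;> omega
  have hcomm : ∀ {x g : G}, x ∈ K → x ∉ center G → g * x = x * g →
      g ∈ center G ∨ x⁻¹ * g ∈ center G :=
    fun hxK hx hg => mem_center_or_of_card_centralizer hx (hC4 _ hxK hx) hg
  have hsq : ∀ g ∈ K, g ^ 2 ∈ center G := fun g hg => sq_mem_center_of_card_centralizer (hC4 g hg)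
  have hwcomm : ∀ x ∈ K, x ∉ center G → w * x ≠ x * w := by
    intro x hxK hx h
    have := orderOf_dvd_card_centralizer h
    rw [hC4 x hxK hx, hw, hz] at this
    omega
  have hconjZ : ∀ x, x ∉ center G → w * x * w⁻¹ ∉ center G := by
    intro x hx h
    apply hx
    have := instNormalCenter.conj_mem _ h w⁻¹
    convert this using 1
    group
  -- If they commuted, conjugation by `w` would multiply `x` by a central `u`. Its cube is trivial,
  -- so `u ^ 3 = 1`; with `u ^ 2 = 1` this gives `u = 1`, and `w` would commute with `x`.
  have hpair : ∀ x ∈ K, x ∉ center G → x * (w * x * w⁻¹) ≠ w * x * w⁻¹ * x := by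
    intro x hxK hx h
    rcases hcomm hxK hx h.symm with h1 | h1
    · exact hconjZ x hx h1
    · set u := x⁻¹ * (w * x * w⁻¹) with hu
      have h2 : w * x * w⁻¹ = x * u := by rw [hu]; group
      have h3 : ∀ n : ℕ, w ^ n * x * (w ^ n)⁻¹ = x * u ^ n := by
        intro n
        induction n with
        | zero => simp
        | succ n ih =>
          calc w ^ (n + 1) * x * (w ^ (n + 1))⁻¹ = w * (w ^ n * x * (w ^ n)⁻¹) * w⁻¹ := by group
            _ = w * x * w⁻¹ * (w * u ^ n * w⁻¹) := by rw [ih]; group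
            _ = x * u * (w * u ^ n * w⁻¹) := by rw [h2]
            _ = x * u ^ (n + 1) := by
              rw [hcen (pow_mem h1 n) w, mul_inv_cancel_right, mul_assoc, ← pow_succ']
      have h4 := h3 3
      rw [hw3, pow_succ, hz2 u h1] at h4
      have hu1 : u = 1 := by simpa using h4
      rw [hu1, mul_one, mul_inv_eq_iff_eq_mul] at h2
      exact hwcomm x hxK hx h2
  obtain ⟨x₀, hx₀K, hx₀⟩ : ∃ x ∈ K, x ∉ center G := by
    by_contra! hle
    have := card_le_of_le (show K ≤ center G from hle)
    omega
  have huniq : ∀ a ∈ center G, ∀ b ∈ center G, a ≠ 1 → b ≠ 1 → a = b := by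
    intro a ha b hb ha1 hb1
    obtain ⟨t, -, ht⟩ := (Nat.card_eq_two_iff' (1 : center G)).1 hz
    have h1 := ht ⟨a, ha⟩ fun h => ha1 (congrArg Subtype.val h)
    have h2 := ht ⟨b, hb⟩ fun h => hb1 (congrArg Subtype.val h)
    exact congrArg Subtype.val (h1.trans h2.symm)
  have htriple : ∀ {a b : G}, a ∈ K → b ∈ K → a * b ≠ b * a → ∃ c, IsCommutatorTriple a b c :=
    fun ha hb h => exists_isCommutatorTriple (hsq _ ha) (hsq _ hb)
      (hsq _ (mul_mem (inv_mem ha) hb)) h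
  -- With `v` the second conjugate of `x₀` under `w`, `y * v` commutes with `x₀` because its two
  -- commutators with `x₀` coincide and cancel. Hence `y * v = x₀ * u` for a central `u`, and
  -- replacing `x₀` by `x₀ * u` absorbs the factor.
  obtain ⟨x, hxK, hx, hv⟩ : ∃ x ∈ K, x ∉ center G ∧
      w * (w * x * w⁻¹) * w⁻¹ = x * (w * x * w⁻¹) := by
    set y := w * x₀ * w⁻¹ with hy
    set v := w * y * w⁻¹ with hv
    have hyK : y ∈ K := hKn.conj_mem _ hx₀K w
    have hvK : v ∈ K := hKn.conj_mem _ hyK w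
    have hyZ := hconjZ x₀ hx₀
    have hvZ := hconjZ y hyZ
    have hwv : w * v * w⁻¹ = x₀ := by
      have : w * v * w⁻¹ = w ^ 3 * x₀ * (w ^ 3)⁻¹ := by
        rw [hv, hy]
        simp only [pow_succ, pow_zero, one_mul]
        group
      rw [this, hw3]
      group
    obtain ⟨c, hc⟩ := htriple hx₀K hyK (hpair x₀ hx₀K hx₀)
    have hxv : x₀ * v ≠ v * x₀ := by
      have := hpair v hvK hvZ
      rw [hwv] at this
      exact this.symm
    obtain ⟨d, hd⟩ := htriple hx₀K hvK hxv
    obtain rfl := huniq d hd.mem_center c hc.mem_center hd.ne_one hc.ne_one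
    have h1 : y * v * x₀ = x₀ * (y * v) := by
      have hdy := hcen hd.mem_center
      calc y * v * x₀ = y * x₀ * (v * d) := by rw [mul_assoc, hd.mul_eq]; group
        _ = x₀ * y * (d * (d * v)) := by rw [hc.mul_eq, hdy v]; group
        _ = x₀ * (y * v) := by rw [← mul_assoc d, ← pow_two, hd.sq_eq_one]; group
    rcases hcomm hx₀K hx₀ h1 with h2 | h2
    · exfalso
      apply hpair y hyK hyZ
      have h3 := hcen h2 y
      rw [mul_assoc y v] at h3
      exact mul_left_cancel h3
    · set u := x₀⁻¹ * (y * v) with hu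
      have hcu : ∀ g, w * (g * u) * w⁻¹ = w * g * w⁻¹ * u := by
        intro g
        have := hcen h2
        rw [← mul_assoc, mul_assoc _ u, ← this w⁻¹, ← mul_assoc]
      have h3 : y * v = x₀ * u := by rw [hu]; group
      have h4 : v * x₀ = y * u := by
        have := congrArg (fun g => w * g * w⁻¹) h3
        simp only [hcu, conj_mul.symm] at this
        rwa [← hv, hwv, ← hy] at this
      have h5 : x₀ * y = v * u := by
        have := congrArg (fun g => w * g * w⁻¹) h4
        simp only [hcu, conj_mul.symm] at this
        rwa [hwv, ← hv, ← hy] at this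
      refine ⟨x₀ * u, mul_mem hx₀K (hZK h2), ?_, ?_⟩
      · intro h
        apply hx₀
        have := mul_mem h (inv_mem h2)
        rwa [mul_inv_cancel_right] at this
      · rw [hcu, hcu, ← hy, ← hv, ← h5, mul_assoc x₀, ← hcen h2 (y * u), mul_assoc y, ← pow_two,
          hz2 u h2, mul_one]
  set y := w * x * w⁻¹ with hy
  have hyK : y ∈ K := hKn.conj_mem _ hxK w
  obtain ⟨c, hc⟩ := htriple hxK hyK (hpair x hxK hx)
  have hy2 : y ^ 2 = x ^ 2 := by
    rw [hy, conj_pow, hcen (hsq x hxK) w, mul_inv_cancel_right]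
  -- If `x ^ 2 = 1`, then `(x * y) ^ 2 = c`; but `x * y` is conjugate to `y`, whose square is 1.
  have hxc : x ^ 2 = c := by
    apply huniq _ (hsq x hxK) _ hc.mem_center _ hc.ne_one
    intro h1
    apply hc.ne_one
    have h2 := hc.mul_sq
    rw [← hv, conj_pow, hy2, h1, mul_one, mul_inv_cancel, one_mul, one_mul] at h2
    exact h2.symm
  have hx4 : x ^ 4 = 1 := by
    rw [show 4 = 2 * 2 from rfl, pow_mul, hz2 _ (hsq x hxK)]
  refine ⟨x, y, w, hx4, hy2, ?_, hw3, hy.symm, hv, ?_, hG⟩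
  · rw [hc.conj_eq, ← hxc, ← pow_succ']
  have hxH : x ∈ closure {w, y, x} := subset_closure (by simp)
  have hyH : y ∈ closure {w, y, x} := subset_closure (by simp)
  have hwH : w ∈ closure {w, y, x} := subset_closure (by simp)
  have hZH : center G ≤ closure {w, y, x} := by
    intro u hu
    by_cases hu1 : u = 1
    · rw [hu1]
      exact one_mem _
    · rw [huniq u hu (x ^ 2) (hsq x hxK) hu1 (hxc ▸ hc.ne_one)]
      exact pow_mem hxH 2
  have h8 : 8 ∣ Nat.card (closure {w, y, x}) := by
    have h1 := four_mul_card_center_le_card (H := closure {w, y, x} ⊓ K) (le_inf hZH hZK)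
      ⟨hxH, hxK⟩ ⟨hyH, hyK⟩ hc.mul_ne
    have h2 : closure {w, y, x} ⊓ K = K := eq_of_le_of_card_ge inf_le_right (by omega)
    rw [← hK]
    exact card_dvd_of_le (inf_eq_right.1 h2)
  have h3 : 3 ∣ Nat.card (closure {w, y, x}) := by
    have := orderOf_dvd_natCard (⟨w, hwH⟩ : closure {w, y, x})
    rwa [orderOf_mk, hw] at this
  apply eq_top_of_card_eq
  have h24 := Nat.Coprime.mul_dvd_of_dvd_of_dvd (by norm_num : Nat.Coprime 8 3) h8 h3
  have := card_subgroup_dvd_card (closure {w, y, x})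
  rw [hG] at this ⊢
  exact Nat.dvd_antisymm this h24

theorem classification_of_card_center_eq_two (hG : ∃ x y : G, x * y ≠ y * x)
    (hz : Nat.card (center G) = 2)
    (hC : ∀ x : G, x ∉ center G → Nat.card (centralizer {x}) ≤ 7) :
    Nonempty (G ≃* DihedralGroup 4) ∨
       Nonempty (G ≃* QuaternionGroup 2) ∨
       Nonempty (G ≃* DihedralGroup 6) ∨
       Nonempty (G ≃* C3sdC4) ∨
       Nonempty (G ≃* Matrix.SpecialLinearGroup (Fin 2) (ZMod 3)) := by
  have h24 := card_dvd_twentyFour hz hC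
  have h4 := four_mul_card_center_le hG
  have hle := Nat.le_of_dvd (by norm_num) h24
  have hcases : Nat.card G = 8 ∨ Nat.card G = 12 ∨ Nat.card G = 24 := by
    generalize Nat.card G = n at *
    interval_cases n <;> omega
  rcases hcases with h | h | h
  · obtain ⟨a, ha⟩ : ∃ a : G, orderOf a = 4 := by
      by_contra! hne
      obtain ⟨x, y, hxy⟩ := id hG
      have hsq : ∀ g : G, g * g = 1 := by
        intro g
        have h1 := orderOf_dvd_natCard g
        have h2 := hne g
        have h3 : orderOf g ≠ 8 := by
          intro h3
          have := isCyclic_of_orderOf_eq_card g (h3.trans h.symm)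
          exact hxy (mul_comm' x y)
        rw [h] at h1
        have h5 := Nat.le_of_dvd (by norm_num) h1
        rw [← pow_two]
        apply orderOf_dvd_iff_pow_eq_one.1
        generalize orderOf g = n at *
        interval_cases n <;> omega
      have hinv : ∀ g : G, g⁻¹ = g := fun g => inv_eq_of_mul_eq_one_left (hsq g)
      apply hxy
      rw [← hinv (x * y), mul_inv_rev, hinv, hinv]
    obtain ⟨b, r, s, hr, hs, hr1, hr2, hrs, hab⟩ := exists_isMetacyclicPair_two hG ha h
    have : r = 3 ∧ (s = 0 ∨ s = 2) := by
      interval_cases r <;> interval_cases s <;> omega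
    obtain ⟨rfl, rfl | rfl⟩ := this
    · left
      exact hab.nonempty_mulEquiv four_pos two_pos (isMetacyclicPair_dihedralGroup 4)
    · right; left
      exact hab.nonempty_mulEquiv four_pos two_pos isMetacyclicPair_quaternionGroup
  · have : Fact (Nat.Prime 2) := ⟨Nat.prime_two⟩
    have : Fact (Nat.Prime 3) := ⟨Nat.prime_three⟩
    obtain ⟨t, ht⟩ := exists_prime_orderOf_dvd_card' (G := G) 3 (by rw [h]; norm_num)
    obtain ⟨⟨z, hzc⟩, hzo⟩ := exists_prime_orderOf_dvd_card' (G := center G) 2 (by rw [hz])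
    rw [orderOf_mk] at hzo
    have hcomm : Commute t z := mem_center_iff.1 hzc t
    -- An element of order 3 times the central involution generates a cyclic subgroup of index 2.
    have ha : orderOf (t * z) = 6 := by
      rw [hcomm.orderOf_mul_eq_mul_orderOf_of_coprime (by rw [ht, hzo]; norm_num), ht, hzo]
    obtain ⟨b, r, s, hr, hs, hr1, hr2, hrs, hab⟩ := exists_isMetacyclicPair_two hG ha h
    have : r = 5 ∧ (s = 0 ∨ s = 3) := by
      interval_cases r <;> interval_cases s <;> omega
    obtain ⟨rfl, rfl | rfl⟩ := this
    · right; right; left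
      exact hab.nonempty_mulEquiv (by norm_num) two_pos (isMetacyclicPair_dihedralGroup 6)
    · right; right; right; left
      exact hab.nonempty_mulEquiv (by norm_num) two_pos isMetacyclicPair_C3sdC4
  · right; right; right; right
    obtain ⟨x, y, w, hxyw⟩ := exists_isBinaryTetrahedralTriple h hz hC
    exact hxyw.nonempty_mulEquiv isBinaryTetrahedralTriple_specialLinearGroup

/-- From `2 * |Z| ≤ |C(x)| ≤ |Z| + 5` the center has at most five elements; 3 and 5 are the excluded
odd primes. -/
theorem card_center_mem_of_card_centralizer_le (hG : ∃ x y : G, x * y ≠ y * x)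
    (hC : ∀ x : G, x ∉ center G → Nat.card (centralizer {x}) ≤ Nat.card (center G) + 5) :
    Nat.card (center G) = 1 ∨ Nat.card (center G) = 2 ∨ Nat.card (center G) = 4 := by
  obtain ⟨x, y, hxy⟩ := id hG
  have hx : x ∉ center G := fun h => hxy (mem_center_iff.1 h y).symm
  have h1 := (two_mul_card_center_le_card_centralizer hx).2
  have h2 := hC x hx
  have hpos : 0 < Nat.card (center G) := Nat.card_pos
  have h3 : Nat.card (center G) ≠ 3 := fun h =>
    card_center_not_odd_prime hG Nat.prime_three (by norm_num) (by norm_num) h (h ▸ hC)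
  have h5 : Nat.card (center G) ≠ 5 := fun h =>
    card_center_not_odd_prime hG Nat.prime_five (by norm_num) (by norm_num) h (h ▸ hC)
  omega

end

/-! ### Assembling the classification -/

theorem finite_nonabelian_strongStarFree_of_mulEquiv {G H : Type*} [Group G] [Group H] [Finite H]
    (e : G ≃* H) (hH : ∃ x y : H, x * y ≠ y * x) (hs : StrongStarFree 5 H) :
    Finite G ∧ (∃ x y : G, x * y ≠ y * x) ∧ StrongStarFree 5 G := by
  refine ⟨Finite.of_equiv H e.symm.toEquiv, ?_, hs.of_mulEquiv e⟩
  obtain ⟨x, y, hxy⟩ := hH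
  refine ⟨e.symm x, e.symm y, fun h => hxy ?_⟩
  rw [← map_mul, ← map_mul] at h
  exact e.symm.injective h

theorem strongStarFree_of_card_le_twelve {H : Type*} [Group H] [Finite H]
    (h : Nat.card H ≤ 12) : StrongStarFree 5 H :=
  strongStarFree_of_card_le (by
    have : 0 < Nat.card (center H) := Nat.card_pos
    omega)

theorem theorem1p1 (G : Type*) [Group G] :
    ((Finite G ∧ (∃ x y : G, x * y ≠ y * x) ∧ StrongStarFree 5 G) ↔
      (Nonempty (G ≃* Equiv.Perm (Fin 3)) ∨
       Nonempty (G ≃* DihedralGroup 5) ∨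
       Nonempty (G ≃* alternatingGroup (Fin 4)) ∨
       Nonempty (G ≃* (ZMod 5 ≃ᵃ[ZMod 5] ZMod 5)) ∨
       Nonempty (G ≃* alternatingGroup (Fin 5)) ∨
       Nonempty (G ≃* DihedralGroup 4) ∨
       Nonempty (G ≃* QuaternionGroup 2) ∨
       Nonempty (G ≃* DihedralGroup 6) ∨
       Nonempty (G ≃* C3sdC4) ∨
       Nonempty (G ≃* Matrix.SpecialLinearGroup (Fin 2) (ZMod 3)) ∨
       IsoToOneOfSix G)) ∧
    ((Nat.card G = 16 ∧ Nat.card (Subgroup.center G) = 4) ↔ IsoToOneOfSix G) := by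
  have hfin : ∀ {n : ℕ}, Nat.card G = n → n ≠ 0 → Finite G := fun h hn =>
    Nat.finite_of_card_ne_zero (h ▸ hn)
  refine ⟨⟨?_, ?_⟩, ?_, IsoToOneOfSix.card⟩
  · rintro ⟨_, hG, hs⟩
    have hC := (strongStarFree_iff 5).1 hs
    rcases card_center_mem_of_card_centralizer_le hG hC with hz | hz | hz
    · have := classification_of_card_center_eq_one hG hz hC
      tauto
    · have := classification_of_card_center_eq_two hG hz (fun x hx => by
        have := hC x hx
        omega)
      tauto
    · have h16 := card_eq_sixteen_of_card_center_eq_four hG hz (fun x hx => by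
        have := hC x hx
        omega)
      have := isoToOneOfSix_of_card h16 hz
      tauto
  · rintro (⟨⟨e⟩⟩ | ⟨⟨e⟩⟩ | ⟨⟨e⟩⟩ | ⟨⟨e⟩⟩ | ⟨⟨e⟩⟩ | ⟨⟨e⟩⟩ | ⟨⟨e⟩⟩ | ⟨⟨e⟩⟩ | ⟨⟨e⟩⟩ | ⟨⟨e⟩⟩ | h)
    · exact finite_nonabelian_strongStarFree_of_mulEquiv e (by decide)
        (strongStarFree_of_card_le_twelve (by rw [isMetacyclicPair_perm.card]; norm_num))
    · exact finite_nonabelian_strongStarFree_of_mulEquiv e (by decide)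
        (strongStarFree_of_card_le_twelve (by rw [DihedralGroup.nat_card]; norm_num))
    · refine finite_nonabelian_strongStarFree_of_mulEquiv e (by decide +kernel)
        (strongStarFree_of_card_le_twelve ?_)
      rw [Nat.card_eq_fintype_card]
      decide +kernel
    · exact finite_nonabelian_strongStarFree_of_mulEquiv e
        ⟨affineFive 1 0, affineFive 0 1, fun h => by
          have := congrArg (fun e => e 0) h
          rw [affineFive_mul, affineFive_mul] at this
          exact absurd this (by decide)⟩ strongStarFree_affineFive
    · refine finite_nonabelian_strongStarFree_of_mulEquiv e ?_ strongStarFree_alternatingGroup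
      by_contra! hall
      have h1 : IsMulCommutative (alternatingGroup (Fin 5)) := ⟨⟨hall⟩⟩
      rw [alternatingGroup.isMulCommutative_iff_card_le_three] at h1
      simp at h1
    · exact finite_nonabelian_strongStarFree_of_mulEquiv e (by decide)
        (strongStarFree_of_card_le_twelve (by rw [DihedralGroup.nat_card]; norm_num))
    · exact finite_nonabelian_strongStarFree_of_mulEquiv e (by decide)
        (strongStarFree_of_card_le_twelve (by
          rw [isMetacyclicPair_quaternionGroup.card]; norm_num))
    · exact finite_nonabelian_strongStarFree_of_mulEquiv e (by decide)
        (strongStarFree_of_card_le_twelve (by rw [DihedralGroup.nat_card]))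
    · exact finite_nonabelian_strongStarFree_of_mulEquiv e (by decide)
        (strongStarFree_of_card_le_twelve (by rw [isMetacyclicPair_C3sdC4.card]))
    · exact finite_nonabelian_strongStarFree_of_mulEquiv e ⟨sl23Gen 0, sl23Gen 1, by decide +kernel⟩
        strongStarFree_specialLinearGroup
    · obtain ⟨hcard, hz⟩ := h.card
      have := hfin hcard (by norm_num)
      refine ⟨this, ?_, strongStarFree_of_card_le (by omega)⟩
      by_contra! hall
      have htop : center G = ⊤ := (eq_top_iff' _).2 fun x => mem_center_iff.2 fun y => hall y x
      rw [htop, card_top] at hz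
      omega
  · rintro ⟨hcard, hz⟩
    have := hfin hcard (by norm_num)
    exact isoToOneOfSix_of_card hcard hz
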